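/- **Setting.** Let the decision sets $\mathcal D$ (Defender) and $\mathcal A$ (Attacker) be non-empty compact metric spaces with finite Borel reference measures of full support (written $\mathrm{d}d$, $\mathrm{d}a$; e.g. Lebesgue measure), and let $\Theta$ be a topological space of outcomes with a $\sigma$-finite Borel reference measure $\mathrm{d}\theta$. The Defender has a utility $u_D(d,\theta)$ and a jointly measurable outcome density $p_D(\theta\mid d,a)$. Her uncertainty about the Attacker is described on a probability space $(\Omega,\mathcal F,\mathcal P)$ by a jointly measurable random utility $U_A^\omega(a,\theta)$, a jointly measurable random outcome density $P_A^\omega(\theta\mid d,a)$ and a random probability distribution $P_A^\omega(\mathrm{d}d)$ on $\mathcal D$. Put $$\Psi_A^\omega(a)=\int\!\!\int U_A^\omega(a,\theta)P_A^\omega(\theta\mid d,a)\,\mathrm{d}\theta\,P_A^\omega(\mathrm{d}d).$$ Let the random optimal attack $A^*$ be an $\mathcal A$-valued random variable with $A^{*\omega}\in\arg\max_{\mathcal A}\Psi_A^\omega$ for almost every $\omega$ for which a maximiser exists, let $p_D(\mathrm{d}a)$ be the law of $A^*$, and let $$\psi_D(d)=\int\!\!\int u_D(d,\theta)\,p_D(\theta\mid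 d,a)\,\mathrm{d}\theta\,p_D(\mathrm{d}a).$$ An element of $\arg\max_{\mathcal D}\psi_D$ is an ARA optimal defense $d^*_{ARA}$. Augmented distributions: $$\pi_D(d,a,\theta)\propto u_D(d,\theta)p_D(\theta\mid d,a)p_D(\mathrm{d}a)\,\mathrm{d}d\,\mathrm{d}\theta,\qquad \Pi_A^\omega(a,d,\theta)\propto U_A^\omega(a,\theta)P_A^\omega(\theta\mid d,a)P_A^\omega(\mathrm{d}d)\,\mathrm{d}a\,\mathrm{d}\theta .$$ **Algorithms.** DAPS, in state $(d',a',\theta')$, draws $d\sim g_D(\cdot\mid d')$, $a\sim p_D$, $\theta\sim p_D(\cdot\mid d,a)$ and moves to $(d,a,\theta)$ with probability $\min\{1,\frac{u_D(d,\theta)g_D(d'\mid d)}{u_D(d',\theta')g_D(d\mid d')}\}$, otherwise it stays. AAPS draws $\omega\sim\mathcal P$ once and then runs the same iteration with the roles of the decisions exchanged, i.e. with $U_A^\omega$, $P_A^\omega$, $g_A$. The initial state is arbitrary (any initial law, with $\omega\sim\mathcal P$ for AAPS) and any fixed number of burn-in samples may be discarded. A *mode* of a distribution is a global maximiser of its continuous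 density with respect to the reference measure. A *mode estimator* maps each finite sample to a point; it is *consistent* for a chain if the target distribution has a mode and, a.s., the distance from the estimates to the set of modes of the target tends to $0$ as the sample size grows. For a continuous function $K\ge 0$ with $K(0)>0$ that vanishes on $[1,\infty)$, a *Parzen mode estimator* with bandwidths $h_n$ returns a maximiser over $x$ of $\frac1n\sum_{i}K(\mathrm{dist}(x,x_i)/h_n)\big/\int K(\mathrm{dist}(x,y)/h_n)\,\mathrm{d}y$. **Assumptions.** 1. $u_D$ and, a.s., $U_A^\omega$ are positive and continuous in $(d,\theta)$, respectively $(a,\theta)$, and are integrable uniformly over the decisions: $\sup_{d,a}\int_{\{u_D(d,\cdot)>B\}}u_D(d,\theta)p_D(\theta\mid d,a)\,\mathrm{d}\theta\to0$ as $B\to\infty$, and a.s. the same for $U_A^\omega,P_A^\omega$ (automatic for bounded utilities). 2. $\mathcal D$ and $\mathcal A$ are compact. 3. $p_D(\theta\mid d,a)$ and, a.s., $P_A^\omega(\theta\mid d,a)$ are positive, and continuous in $d$, respectively in $a$. 4. $g_D(\cdot\mid d')$ and $g_A(\cdot\mid a')$ are jointly measurable probability densities that are positive on all of $\mathcal D$,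 respectively $\mathcal A$. **Proposition 1.** (DAPS) DAPS defines a Markov chain; $\pi_D$ is a well-defined probability distribution and is the unique stationary distribution of the chain. The $d$-marginal of $\pi_D$ has density $\psi_D/\int\psi_D$, $\psi_D$ is continuous, $\arg\max\psi_D\neq\emptyset$, and the modes of the $d$-marginal are exactly the optimal defenses $d^*_{ARA}$. For every mode estimator based on the $d$-samples of this chain that is consistent for the $d$-marginal of $\pi_D$, the estimates a.s. approach $\arg\max\psi_D$ (hence converge a.s. to $d^*_{ARA}$ if it is unique); and for every $K$ as above there are bandwidths $0<h_n\to0$ such that every Parzen mode estimator with these bandwidths is consistent. (AAPS) For almost every $\omega$ the same holds for AAPS: given $\omega$ it is a Markov chain, $\Pi_A^\omega$ is a well-defined probability distribution and is its unique stationary distribution, the $a$-marginal of $\Pi_A^\omega$ has density $\Psi_A^\omega/\int\Psi_A^\omega$, $\Psi_A^\omega$ is continuous with a non-empty set of maximisers, which are exactly the modes of the $a$-marginal, and $A^{*\omega}$ is one of them. For every mode estimator based on the $a$-samples that is consistent for the $a$-marginal of $\Pi_A^\omega$ (under the joint law of $\omega$ and the chain), the estimates a.s. approach $\arg\max\Psi_A^\omega$;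 if the maximiser is a.s. unique, they converge a.s. to a random variable that equals $A^{*\omega}$ and has law $p_D(\mathrm{d}a)$. For every $K$ as above there are bandwidths $0<h_n\to0$ such that every Parzen mode estimator with these bandwidths is consistent. -/

import Mathlib

open MeasureTheory ProbabilityTheory Filter Topology

/-! Throughout, `X` is the set of decisions of the agent who optimises, `Y` the set of decisions of
the opponent and `Θ` the set of outcomes. `lX` and `lT` are the reference measures on `X` and `Θ`
(Lebesgue measure for continuous problems), `ν` is the agent's forecast of the opponent's
decision, `u x θ` her utility, `p x y θ` the density of the outcome given both decisions, and
`g x' x` the density at `x` of the proposal made from `x'`. For the Defender `(X, Y) = (D, A)`, for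
the Attacker `(X, Y) = (A, D)`. -/

namespace APS

noncomputable section

/-- The expected utility `ψ(x) = ∫ (∫ u(x,θ) p(θ | x,y) dθ) ν(dy)`. -/
def expectedUtility {X Y Θ : Type*} [MeasurableSpace Y] [MeasurableSpace Θ]
    (lT : Measure Θ) (ν : Measure Y) (u : X → Θ → ℝ) (p : X → Y → Θ → ℝ) (x : X) : ℝ :=
  ∫ y, (∫ θ, u x θ * p x y θ ∂lT) ∂ν

/-- The set of global maximisers of `f`. -/
def argmaxSet {X : Type*} (f : X → ℝ) : Set X := {x | ∀ y, f y ≤ f x}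

/-- The measure with density `u(x,θ) p(θ | x,y)` with respect to `lX ⊗ ν ⊗ lT`. -/
def unnormalizedAugmented {X Y Θ : Type*} [MeasurableSpace X] [MeasurableSpace Y]
    [MeasurableSpace Θ] (lX : Measure X) (ν : Measure Y) (lT : Measure Θ)
    (u : X → Θ → ℝ) (p : X → Y → Θ → ℝ) : Measure (X × Y × Θ) :=
  (lX.prod (ν.prod lT)).withDensity
    fun s => ENNReal.ofReal (u s.1 s.2.2 * p s.1 s.2.1 s.2.2)

/-- The augmented distribution `π(x,y,θ) ∝ u(x,θ) p(θ | x,y) ν(y)`. -/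
def augmented {X Y Θ : Type*} [MeasurableSpace X] [MeasurableSpace Y]
    [MeasurableSpace Θ] (lX : Measure X) (ν : Measure Y) (lT : Measure Θ)
    (u : X → Θ → ℝ) (p : X → Y → Θ → ℝ) : Measure (X × Y × Θ) :=
  (unnormalizedAugmented lX ν lT u p Set.univ)⁻¹ • unnormalizedAugmented lX ν lT u p

/-- The acceptance probability of the candidate `s = (x,y,θ)` in the state `s' = (x',y',θ')`,
`min {1, u(x,θ) g(x' | x) / (u(x',θ') g(x | x'))}`. -/
def acceptProb {X Y Θ : Type*} (u : X → Θ → ℝ) (g : X → X → ℝ) (s' s : X × Y × Θ) : ℝ :=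
  min 1 ((u s.1 s.2.2 * g s.1 s'.1) / (u s'.1 s'.2.2 * g s'.1 s.1))

/-- The law of the candidate `(x,y,θ)` in the state `s' = (x',y',θ')`:
`x ~ g(· | x')`, `y ~ ν`, `θ ~ p(· | x,y)`. -/
def candidateLaw {X Y Θ : Type*} [MeasurableSpace X] [MeasurableSpace Y]
    [MeasurableSpace Θ] (lX : Measure X) (ν : Measure Y) (lT : Measure Θ)
    (p : X → Y → Θ → ℝ) (g : X → X → ℝ) (s' : X × Y × Θ) : Measure (X × Y × Θ) :=
  (lX.prod (ν.prod lT)).withDensity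
    fun s => ENNReal.ofReal (g s'.1 s.1 * p s.1 s.2.1 s.2.2)

/-- The law of the next state of the Metropolis-Hastings iteration from the state `s'`: the
candidate is accepted with probability `acceptProb`, otherwise the state is kept. -/
def mhStep {X Y Θ : Type*} [MeasurableSpace X] [MeasurableSpace Y]
    [MeasurableSpace Θ] (lX : Measure X) (ν : Measure Y) (lT : Measure Θ)
    (u : X → Θ → ℝ) (p : X → Y → Θ → ℝ) (g : X → X → ℝ) (s' : X × Y × Θ) :
    Measure (X × Y × Θ) :=
  (candidateLaw lX ν lT p g s').withDensity (fun s => ENNReal.ofReal (acceptProb u g s' s))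
    + (∫⁻ s, ENNReal.ofReal (1 - acceptProb u g s' s) ∂candidateLaw lX ν lT p g s') •
      Measure.dirac s'

/-- The law, on the space of trajectories, of the time-homogeneous Markov chain with transition
kernel `κ` and initial law `μ₀`. -/
def chainLaw {S : Type*} [MeasurableSpace S] (κ : Kernel S S) [IsMarkovKernel κ]
    (μ₀ : Measure S) : Measure (ℕ → S) :=
  Kernel.trajMeasure (X := fun _ => S) μ₀
    fun n => κ.comap (fun x => x ⟨n, Finset.mem_Iic.2 le_rfl⟩) (measurable_pi_apply _)

/-- The modes of `μ`: the global maximisers of its continuous density with respect to `lX`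
(which is unique when `lX` has full support). -/
def modeSet {X : Type*} [TopologicalSpace X] [MeasurableSpace X] (lX μ : Measure X) : Set X :=
  {x | ∃ f : X → ℝ, Continuous f ∧ (∀ y, 0 ≤ f y) ∧
    μ = lX.withDensity (fun y => ENNReal.ofReal (f y)) ∧ ∀ y, f y ≤ f x}

/-- A mode estimator assigns to each finite sample a point, `m n : (Fin n → X) → X`. Under the law
`Q`, with data `obs z 0, obs z 1, …` and target distribution `target z`, it is (strongly)
consistent if the target has a mode and the estimates almost surely approach the modes of the
target as the sample size grows. The target is allowed to be random, because the Attacker's is. -/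
def IsConsistentModeEstimator {X Z : Type*} [MetricSpace X] [MeasurableSpace X]
    [MeasurableSpace Z] (Q : Measure Z) (lX : Measure X) (target : Z → Measure X)
    (obs : Z → ℕ → X) (m : (n : ℕ) → (Fin n → X) → X) : Prop :=
  ∀ᵐ z ∂Q, (modeSet lX (target z)).Nonempty ∧
    Tendsto (fun n => Metric.infDist (m n fun i => obs z i) (modeSet lX (target z)))
      atTop (𝓝 0)

/-- A smoothing kernel profile: continuous, nonnegative, positive at `0`, supported in `[0,1]`. -/
structure IsSmoothingKernel (K : ℝ → ℝ) : Prop where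
  continuous : Continuous K
  nonneg : ∀ t, 0 ≤ K t
  pos : 0 < K 0
  support : ∀ t, 1 ≤ t → K t = 0

/-- Parzen's kernel density estimate with bandwidth `h` at `x` from the sample `xs`, each bump
being normalised so that constants are reproduced up to the boundary of `X`. -/
def kernelDensity {X : Type*} [MetricSpace X] [MeasurableSpace X] (lX : Measure X)
    (K : ℝ → ℝ) (h : ℝ) {n : ℕ} (xs : Fin n → X) (x : X) : ℝ :=
  ((n : ℝ)⁻¹ * ∑ i, K (dist x (xs i) / h)) / ∫ y, K (dist x y / h) ∂lX

/-- `m` is Parzen's mode estimator with profile `K` and bandwidths `h n`: the estimate is a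
maximiser of the kernel density estimate. -/
def IsParzenModeEstimator {X : Type*} [MetricSpace X] [MeasurableSpace X] (lX : Measure X)
    (K : ℝ → ℝ) (h : ℕ → ℝ) (m : (n : ℕ) → (Fin n → X) → X) : Prop :=
  ∀ n xs, m n xs ∈ argmaxSet (kernelDensity lX K (h n) xs)

/-- The assumptions on the utility and the outcome model of an agent. Continuity of the outcome
density is only required in the agent's own decision. -/
structure IsRegularModel {X Y Θ : Type*} [TopologicalSpace X] [TopologicalSpace Θ]
    [MeasurableSpace Θ] (lT : Measure Θ) (u : X → Θ → ℝ) (p : X → Y → Θ → ℝ) : Prop where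
  utility_pos : ∀ x θ, 0 < u x θ
  utility_continuous : Continuous fun z : X × Θ => u z.1 z.2
  /-- The utility is integrable with respect to the outcome distributions, uniformly in the
  decisions (automatic if the utility is bounded, in particular if `Θ` is compact). -/
  utility_integrable : ∀ ε : ℝ, 0 < ε → ∃ B : ℝ, ∀ x y,
    ∫⁻ θ in {θ | B < u x θ}, ENNReal.ofReal (u x θ * p x y θ) ∂lT ≤ ENNReal.ofReal ε
  density_pos : ∀ x y θ, 0 < p x y θ
  density_one : ∀ x y, ∫⁻ θ, ENNReal.ofReal (p x y θ) ∂lT = 1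
  density_continuous : ∀ y θ, Continuous fun x => p x y θ

/-- `g x' x` is, as a function of `x`, a probability density with support the whole of `X`. -/
structure IsFullProposal {X : Type*} [MeasurableSpace X] (lX : Measure X) (g : X → X → ℝ) :
    Prop where
  measurable : Measurable fun z : X × X => g z.1 z.2
  pos : ∀ x' x, 0 < g x' x
  density_one : ∀ x', ∫⁻ x, ENNReal.ofReal (g x' x) ∂lX = 1

/-- The Metropolis-Hastings iteration is the Markov chain with kernel `κ`; the augmented
distribution is well defined and is its one and only stationary distribution; the marginal of the
augmented distribution in the agent's decision is proportional to the expected utility; optimal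
decisions exist and are exactly the modes of that marginal. -/
structure SamplesAugmented {X Y Θ : Type*} [TopologicalSpace X] [MeasurableSpace X]
    [MeasurableSpace Y] [MeasurableSpace Θ] (lX : Measure X) (ν : Measure Y) (lT : Measure Θ)
    (u : X → Θ → ℝ) (p : X → Y → Θ → ℝ) (g : X → X → ℝ)
    (κ : Kernel (X × Y × Θ) (X × Y × Θ)) : Prop where
  kernel_eq : ∀ s, κ s = mhStep lX ν lT u p g s
  isProbability : IsProbabilityMeasure (augmented lX ν lT u p)
  stationary : κ.Invariant (augmented lX ν lT u p)
  unique : ∀ μ : Measure (X × Y × Θ), IsProbabilityMeasure μ → κ.Invariant μ →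
    μ = augmented lX ν lT u p
  marginal : (augmented lX ν lT u p).map Prod.fst = lX.withDensity fun x => ENNReal.ofReal
    (expectedUtility lT ν u p x / ∫ x', expectedUtility lT ν u p x' ∂lX)
  continuous : Continuous (expectedUtility lT ν u p)
  exists_optimal : (argmaxSet (expectedUtility lT ν u p)).Nonempty
  modes_eq : modeSet lX ((augmented lX ν lT u p).map Prod.fst) =
    argmaxSet (expectedUtility lT ν u p)

end

end APS

/-! All densities and acceptance probabilities are positive, so from every state the chain either
moves, with positive probability, by a law equivalent to the augmented distribution `π`, or stays
put (`mhStep_decomposition`). Detailed balance (`weight_mul_candidate_mul_accept`) makes `π`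
invariant. These two facts carry the whole ergodic theory; no irreducibility or recurrence theory
enters.

The law of large numbers rests on a maximal ergodic theorem (`setIntegral_unboundedSet_nonneg`): a
bounded function has nonnegative integral over the paths on which its sums are unbounded above. The
probability of this shift-invariant event, as a function of the starting point, is harmonic and
therefore `π`-a.e. constant (`ae_eq_const_of_harmonic`). If the function has negative mean, that
constant must vanish. Applying this to `φ` and `-φ`, each shifted by slightly more than its mean,
gives convergence of time averages under the stationary law. The move-or-stay form of a step extends
it to every starting point (`ae_tendsto_timeAverage`), and taking expectations of time averages
shows that `π` is the only stationary distribution (`eq_of_invariant`).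

Integrating out the opponent's decision and the outcome leaves the density `ψ / ∫ ψ`. The expected
utility `ψ` is continuous although the outcome density is only pointwise continuous in the decision:
a Scheffé-type argument (`continuous_integral_of_add_eq_const`) treats truncated utilities, and the
uniform tail bound passes to the limit. As the reference measure has full support, the continuous
density is unique, so modes are maximisers of `ψ` (`modeSet_eq`). The claim on consistent mode
estimators is then a rewriting.

For Parzen's estimator, at each fixed bandwidth the law of large numbers on a finite net controls
the error uniformly in the point (`exists_net`). Egorov's theorem and Borel–Cantelli allow the
bandwidth to shrink slowly (`exists_diagonal`). For the Attacker, `ω` is a coordinate of the state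
that never moves; given `ω` the chain is that of a fixed model (`pathKernel_deterministic_prod`).
The diagonal argument is run under the joint law, which yields bandwidths that do not depend on `ω`.
-/

namespace APS

noncomputable section

set_option linter.unusedSectionVars false

/-! ### The law of a Markov chain on the space of trajectories -/

section Chain

variable {S : Type*} [MeasurableSpace S]

/-- The shift on trajectories. -/
def shift (z : ℕ → S) : ℕ → S := fun n => z (n + 1)

lemma measurable_shift : Measurable (shift : (ℕ → S) → ℕ → S) :=
  measurable_pi_lambda _ fun n => measurable_pi_apply (n + 1)

/-- `Q` is the law of a Markov chain with initial law `μ₀` and transition kernel `κ`. -/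
structure IsChainLaw (κ : Kernel S S) (μ₀ : Measure S) (Q : Measure (ℕ → S)) : Prop where
  initial : Q.map (fun z => z 0) = μ₀
  step : ∀ (n : ℕ) (G : (Finset.Iic n → S) × S → ENNReal), Measurable G →
    ∫⁻ z, G (Preorder.frestrictLe n z, z (n + 1)) ∂Q =
      ∫⁻ z, ∫⁻ s, G (Preorder.frestrictLe n z, s) ∂κ (z n) ∂Q

/-- The law of the chain as a kernel in its starting point. -/
def pathKernel (κ : Kernel S S) [IsMarkovKernel κ] : Kernel S (ℕ → S) :=
  (Kernel.traj (X := fun _ => S)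
    (fun n => κ.comap (fun x => x ⟨n, Finset.mem_Iic.2 le_rfl⟩) (measurable_pi_apply _)) 0).comap
      (fun s _ => s) (measurable_pi_lambda _ fun _ => measurable_id)

instance (κ : Kernel S S) [IsMarkovKernel κ] : IsMarkovKernel (pathKernel κ) := by
  unfold pathKernel; infer_instance

lemma chainLaw_eq_bind (κ : Kernel S S) [IsMarkovKernel κ] (μ₀ : Measure S) :
    chainLaw κ μ₀ = μ₀.bind (pathKernel κ) := by
  unfold chainLaw Kernel.trajMeasure pathKernel
  ext A hA
  rw [Measure.bind_apply hA (Kernel.aemeasurable _), Measure.bind_apply hA (Kernel.aemeasurable _),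
    lintegral_map (Kernel.measurable_coe _ hA) (MeasurableEquiv.measurable _)]
  rfl

lemma pathKernel_map_zero (κ : Kernel S S) [IsMarkovKernel κ] (s : S) :
    (pathKernel κ s).map (fun z => z 0) = Measure.dirac s := by
  have h := Kernel.traj_map_frestrictLe_of_le (X := fun _ => S)
      (κ := fun n => κ.comap (fun x => x ⟨n, Finset.mem_Iic.2 le_rfl⟩) (measurable_pi_apply _))
      (le_refl 0)
  have h2 := congrArg (fun η => (η (fun _ => s)).map fun w => w ⟨0, Finset.mem_Iic.2 le_rfl⟩) h
  simp only [Kernel.deterministic_apply] at h2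
  rw [Kernel.map_apply _ (by fun_prop), Measure.map_map (by fun_prop) (by fun_prop),
    Measure.map_dirac' (by fun_prop)] at h2
  exact h2

instance (κ : Kernel S S) [IsMarkovKernel κ] (μ₀ : Measure S) [IsProbabilityMeasure μ₀] :
    IsProbabilityMeasure (chainLaw κ μ₀) := by
  rw [chainLaw_eq_bind]; infer_instance

lemma isChainLaw_chainLaw (κ : Kernel S S) [IsMarkovKernel κ] (μ₀ : Measure S)
    [IsProbabilityMeasure μ₀] : IsChainLaw κ μ₀ (chainLaw κ μ₀) where
  initial := by
    refine Measure.ext_of_lintegral _ fun f hf => ?_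
    rw [chainLaw_eq_bind, lintegral_map hf (by fun_prop),
      Measure.lintegral_bind (f := fun z : ℕ → S => f (z 0)) (by fun_prop)
        (hf.comp (measurable_pi_apply 0)).aemeasurable]
    refine lintegral_congr fun s => ?_
    rw [← lintegral_map hf (by fun_prop), pathKernel_map_zero, lintegral_dirac' _ hf]
  step n G hG := by
    have h := Kernel.map_frestrictLe_trajMeasure_compProd_eq_map_trajMeasure (X := fun _ => S)
      (κ := fun n => κ.comap (fun x => x ⟨n, Finset.mem_Iic.2 le_rfl⟩) (measurable_pi_apply _))
      (μ₀ := μ₀) (a := n)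
    have h2 : ∫⁻ w, G w ∂_ = ∫⁻ w, G w ∂_ := congrArg (fun μ => ∫⁻ w, G w ∂μ) h
    rw [Measure.lintegral_compProd hG, lintegral_map hG (by fun_prop),
      lintegral_map (by fun_prop) (by fun_prop)] at h2
    exact h2.symm

lemma IsChainLaw.isProbabilityMeasure {κ : Kernel S S} {μ₀ : Measure S} [IsProbabilityMeasure μ₀]
    {Q : Measure (ℕ → S)} (h : IsChainLaw κ μ₀ Q) : IsProbabilityMeasure Q := by
  have h0 := h.initial
  constructor
  rw [← Set.preimage_univ (f := fun z : ℕ → S => z 0),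
    ← Measure.map_apply (measurable_pi_apply 0) MeasurableSet.univ, h0, measure_univ]

/-- Induction on time: the step rule expresses the law of the path up to `n + 1` through `κ` and the
law of the path up to `n`. -/
lemma IsChainLaw.map_frestrictLe_eq {κ : Kernel S S} {μ₀ : Measure S}
    {Q Q' : Measure (ℕ → S)} (h : IsChainLaw κ μ₀ Q) (h' : IsChainLaw κ μ₀ Q') [IsMarkovKernel κ] (n : ℕ) :
    Q.map (Preorder.frestrictLe (π := fun _ => S) n) =
      Q'.map (Preorder.frestrictLe (π := fun _ => S) n) := by
  induction n with
  | zero =>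
    have e : (Preorder.frestrictLe (π := fun _ => S) 0) =
        (fun (s : S) (_ : Finset.Iic 0) => s) ∘ fun z : ℕ → S => z 0 := by
      funext z i
      obtain ⟨i, hi⟩ := i
      obtain rfl : i = 0 := by simpa using hi
      rfl
    have m : Measurable (fun (s : S) (_ : Finset.Iic 0) => s) := by fun_prop
    rw [e, ← Measure.map_map m (measurable_pi_apply 0), ← Measure.map_map m (measurable_pi_apply 0),
      h.initial, h'.initial]
  | succ n ih =>
    -- `e` appends a new state to a path of length `n + 1`.
    let e : (Finset.Iic n → S) × S → (Finset.Iic (n + 1) → S) := fun w i =>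
      if hi : i.1 ≤ n then w.1 ⟨i.1, Finset.mem_Iic.2 hi⟩ else w.2
    have me : Measurable e := by
      refine measurable_pi_lambda _ fun i => ?_
      by_cases hi : i.1 ≤ n
      · simp only [e, hi, dite_true]; fun_prop
      · simp only [e, hi, dite_false]; fun_prop
    have he : ∀ z : ℕ → S, Preorder.frestrictLe (π := fun _ => S) (n + 1) z =
        e (Preorder.frestrictLe n z, z (n + 1)) := by
      intro z
      funext i
      by_cases hi : i.1 ≤ n
      · simp [e, hi]
      · have : i.1 = n + 1 := by have := Finset.mem_Iic.1 i.2; omega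
        simp [e, hi, ← this]
    have key : ∀ {Q₁ : Measure (ℕ → S)}, IsChainLaw κ μ₀ Q₁ → ∀ f : (Finset.Iic (n + 1) → S) → ENNReal,
        Measurable f → ∫⁻ w, f w ∂Q₁.map (Preorder.frestrictLe (π := fun _ => S) (n + 1)) =
          ∫⁻ w, ∫⁻ s, f (e (w, s)) ∂κ (w ⟨n, Finset.mem_Iic.2 le_rfl⟩)
            ∂Q₁.map (Preorder.frestrictLe (π := fun _ => S) n) := by
      intro Q₁ hR f hf
      rw [lintegral_map hf (by fun_prop), lintegral_map _ (by fun_prop)]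
      · simp_rw [he]
        exact hR.step n (fun w => f (e w)) (hf.comp me)
      · exact Measurable.lintegral_kernel_prod_right (κ := κ.comap
          (fun w : Finset.Iic n → S => w ⟨n, Finset.mem_Iic.2 le_rfl⟩) (measurable_pi_apply _))
          (f := fun w s => f (e (w, s))) (hf.comp me)
    refine Measure.ext_of_lintegral _ fun f hf => ?_
    rw [key h f hf, key h' f hf, ih]

/-- Equal finite-dimensional laws force equal projective limits. This is how the shifted chain and
the chain with a frozen component are recognised as chains. -/
lemma IsChainLaw.eq {κ : Kernel S S} [IsMarkovKernel κ] {μ₀ : Measure S} [IsProbabilityMeasure μ₀]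
    {Q Q' : Measure (ℕ → S)} (h : IsChainLaw κ μ₀ Q) (h' : IsChainLaw κ μ₀ Q') : Q = Q' := by
  have := h.isProbabilityMeasure
  have := h'.isProbabilityMeasure
  have hp : IsProjectiveMeasureFamily (α := fun _ => S)
    (fun I : Finset ℕ => Q.map (I.restrict (π := fun _ => S))) := by
    intro I J hJ
    exact (Measure.map_map (Finset.measurable_restrict₂ (X := fun _ => S) hJ)
      (Finset.measurable_restrict (X := fun _ => S) I)).symm
  have h1 : IsProjectiveLimit Q (α := fun _ => S)
    (fun I : Finset ℕ => Q.map (I.restrict (π := fun _ => S))) :=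
    fun I => rfl
  refine h1.unique ?_
  rw [isProjectiveLimit_nat_iff hp]
  exact fun n => (h.map_frestrictLe_eq h' n).symm

lemma IsChainLaw.eq_chainLaw {κ : Kernel S S} [IsMarkovKernel κ] {μ₀ : Measure S}
    [IsProbabilityMeasure μ₀] {Q : Measure (ℕ → S)} (h : IsChainLaw κ μ₀ Q) : Q = chainLaw κ μ₀ :=
  h.eq (isChainLaw_chainLaw κ μ₀)

lemma pathKernel_apply (κ : Kernel S S) [IsMarkovKernel κ] (s : S) :
    pathKernel κ s = chainLaw κ (Measure.dirac s) := by
  rw [chainLaw_eq_bind, Measure.dirac_bind (Kernel.measurable _)]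

lemma chainLaw_map_zero (κ : Kernel S S) [IsMarkovKernel κ] (μ₀ : Measure S)
    [IsProbabilityMeasure μ₀] : (chainLaw κ μ₀).map (fun z => z 0) = μ₀ :=
  (isChainLaw_chainLaw κ μ₀).initial

lemma chainLaw_map_succ (κ : Kernel S S) [IsMarkovKernel κ] (μ₀ : Measure S)
    [IsProbabilityMeasure μ₀] (n : ℕ) :
    (chainLaw κ μ₀).map (fun z => z (n + 1)) = ((chainLaw κ μ₀).map fun z => z n).bind κ := by
  refine Measure.ext_of_lintegral _ fun f hf => ?_
  rw [lintegral_map hf (by fun_prop), Measure.lintegral_bind (by fun_prop) hf.aemeasurable,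
    lintegral_map (by fun_prop) (by fun_prop)]
  exact (isChainLaw_chainLaw κ μ₀).step n (fun w => f w.2) (hf.comp measurable_snd)

/-- The chain seen from time one on is the chain started from its law at time one. -/
lemma chainLaw_map_shift (κ : Kernel S S) [IsMarkovKernel κ] (μ₀ : Measure S)
    [IsProbabilityMeasure μ₀] : (chainLaw κ μ₀).map shift = chainLaw κ (μ₀.bind κ) := by
  refine IsChainLaw.eq_chainLaw ⟨?_, fun n G hG => ?_⟩
  · rw [Measure.map_map (by fun_prop) measurable_shift]
    have := chainLaw_map_succ κ μ₀ 0
    rwa [chainLaw_map_zero] at this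
  -- `r` forgets time zero: the past of the shifted path up to `n` is a function of the original
  -- past up to `n + 1`, so the step rule at `n + 1` applies.
  · let r : (Finset.Iic (n + 1) → S) → (Finset.Iic n → S) := fun w i =>
      w ⟨i.1 + 1, Finset.mem_Iic.2 (Nat.succ_le_succ (Finset.mem_Iic.1 i.2))⟩
    have mr : Measurable r := measurable_pi_lambda _ fun i => measurable_pi_apply _
    rw [lintegral_map (by fun_prop) measurable_shift, lintegral_map _ measurable_shift]
    · exact (isChainLaw_chainLaw κ μ₀).step (n + 1) (fun w => G (r w.1, w.2))
        (hG.comp ((mr.comp measurable_fst).prodMk measurable_snd))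
    · exact Measurable.lintegral_kernel_prod_right (κ := κ.comap
          (fun z : ℕ → S => z n) (measurable_pi_apply _))
          (f := fun z s => G (Preorder.frestrictLe (π := fun _ => S) n z, s)) (by fun_prop)

lemma pathKernel_map_shift (κ : Kernel S S) [IsMarkovKernel κ] (s : S) :
    (pathKernel κ s).map shift = (κ s).bind (pathKernel κ) := by
  rw [pathKernel_apply, chainLaw_map_shift, Measure.dirac_bind (Kernel.measurable _),
    chainLaw_eq_bind]

lemma measurePreserving_shift {κ : Kernel S S} [IsMarkovKernel κ] {μ : Measure S}
    [IsProbabilityMeasure μ] (h : κ.Invariant μ) :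
    MeasurePreserving shift (chainLaw κ μ) (chainLaw κ μ) :=
  ⟨measurable_shift, by rw [chainLaw_map_shift, h.def]⟩

lemma chainLaw_map_eval {κ : Kernel S S} [IsMarkovKernel κ] {μ : Measure S}
    [IsProbabilityMeasure μ] (h : κ.Invariant μ) (n : ℕ) :
    (chainLaw κ μ).map (fun z => z n) = μ := by
  induction n with
  | zero => exact chainLaw_map_zero κ μ
  | succ n ih => rw [chainLaw_map_succ, ih, h.def]

lemma pathKernel_ae_zero (κ : Kernel S S) [IsMarkovKernel κ] {s : S} {A : Set S}
    (hA : MeasurableSet A) (hs : s ∈ A) : ∀ᵐ z ∂pathKernel κ s, z 0 ∈ A := by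
  have h2 : ∀ᵐ t ∂(pathKernel κ s).map (fun z => z 0), t ∈ A := by
    rw [pathKernel_map_zero]; exact (ae_dirac_iff hA).2 hs
  exact ae_of_ae_map (measurable_pi_apply 0).aemeasurable h2

/-- A chain with a component that stays put is the chain of the other component. -/
lemma pathKernel_deterministic_prod {Ω : Type*} [MeasurableSpace Ω] (κ : Kernel (Ω × S) S)
    [IsMarkovKernel κ] (ω : Ω) (s : S) :
    pathKernel (Kernel.deterministic Prod.fst measurable_fst ×ₖ κ) (ω, s) =
      (pathKernel (κ.comap (fun s => (ω, s)) measurable_prodMk_left) s).map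
        (fun z i => (ω, z i)) := by
  have m : Measurable (fun (z : ℕ → S) i => (ω, z i)) := by fun_prop
  rw [pathKernel_apply, pathKernel_apply]
  refine (IsChainLaw.eq_chainLaw ⟨?_, fun n G hG => ?_⟩).symm
  · rw [Measure.map_map (by fun_prop) m]
    have : Measure.map (fun s => (ω, s)) _ = Measure.map (fun s => (ω, s)) _ :=
      congrArg (fun μ => μ.map (fun s => (ω, s))) (chainLaw_map_zero
      (κ.comap (fun s => (ω, s)) measurable_prodMk_left) (Measure.dirac s))
    rw [Measure.map_map (by fun_prop) (by fun_prop), Measure.map_dirac' (by fun_prop)] at this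
    exact this
  · rw [lintegral_map (by fun_prop) m, lintegral_map _ m]
    · refine ((isChainLaw_chainLaw (κ.comap (fun s => (ω, s)) measurable_prodMk_left)
        (Measure.dirac s)).step n (fun w => G (fun i => (ω, w.1 i), (ω, w.2))) (by fun_prop)).trans ?_
      refine lintegral_congr fun z => ?_
      rw [Kernel.prod_apply, Kernel.deterministic_apply, Measure.dirac_prod,
        lintegral_map (by fun_prop) (by fun_prop)]
      rfl
    · exact Measurable.lintegral_kernel_prod_right
        (κ := (Kernel.deterministic Prod.fst measurable_fst ×ₖ κ).comap
          (fun z : ℕ → Ω × S => z n) (measurable_pi_apply _))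
          (f := fun z s => G (Preorder.frestrictLe (π := fun _ => Ω × S) n z, s)) (by fun_prop)

end Chain

/-! ### The maximal ergodic theorem -/

section Maximal

variable {Z : Type*}

/-- The maximum of `0` and the first `n` Birkhoff sums of `F`. -/
def maxSum (T : Z → Z) (F : Z → ℝ) : ℕ → Z → ℝ
  | 0 => fun _ => 0
  | n + 1 => fun z => max 0 (F z + maxSum T F n (T z))

lemma maxSum_nonneg (T : Z → Z) (F : Z → ℝ) (n : ℕ) (z : Z) : 0 ≤ maxSum T F n z := by
  cases n with
  | zero => exact le_rfl
  | succ n => exact le_max_left _ _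

lemma maxSum_le_succ (T : Z → Z) (F : Z → ℝ) (n : ℕ) (z : Z) :
    maxSum T F n z ≤ maxSum T F (n + 1) z := by
  induction n generalizing z with
  | zero => exact maxSum_nonneg T F 1 z
  | succ n ih => exact max_le_max le_rfl (by gcongr; exact ih (T z))

lemma maxSum_mono (T : Z → Z) (F : Z → ℝ) (z : Z) : Monotone fun n => maxSum T F n z :=
  monotone_nat_of_le_succ fun n => maxSum_le_succ T F n z

lemma birkhoffSum_le_maxSum (T : Z → Z) (F : Z → ℝ) (n : ℕ) (z : Z) :
    birkhoffSum T F n z ≤ maxSum T F n z := by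
  induction n generalizing z with
  | zero => simp [maxSum]
  | succ n ih =>
    rw [birkhoffSum_succ']
    exact (add_le_add le_rfl (ih (T z))).trans (le_max_right _ _)

lemma maxSum_le {T : Z → Z} {F : Z → ℝ} {C : ℝ} (hF : ∀ z, |F z| ≤ C) (n : ℕ) (z : Z) :
    maxSum T F n z ≤ n * C := by
  induction n generalizing z with
  | zero => simp [maxSum]
  | succ n ih =>
    have h1 := ih (T z)
    have h2 := abs_le.1 (hF z)
    have h0 : 0 ≤ C := (abs_nonneg _).trans (hF z)
    push_cast
    exact max_le (by positivity) (by linarith)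

/-- The points with unbounded Birkhoff sums. -/
def unboundedSet (T : Z → Z) (F : Z → ℝ) : Set Z := {z | ∀ C : ℕ, ∃ n, (C : ℝ) < maxSum T F n z}

lemma mem_unboundedSet_iff_tendsto {T : Z → Z} {F : Z → ℝ} {z : Z} :
    z ∈ unboundedSet T F ↔ Tendsto (fun n => maxSum T F n z) atTop atTop := by
  constructor
  · intro h
    refine tendsto_atTop_atTop_of_monotone (maxSum_mono T F z) fun b => ?_
    obtain ⟨C, hC⟩ := exists_nat_ge b
    obtain ⟨n, hn⟩ := h C
    exact ⟨n, hC.trans hn.le⟩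
  · intro h C
    exact (h.eventually_gt_atTop (C : ℝ)).exists

/-- As soon as the maximum at `z` is positive it equals `F z` plus the previous maximum at `T z`, so
the two sequences diverge together. -/
lemma preimage_unboundedSet (T : Z → Z) (F : Z → ℝ) :
    T ⁻¹' unboundedSet T F = unboundedSet T F := by
  ext z
  rw [Set.mem_preimage, mem_unboundedSet_iff_tendsto, mem_unboundedSet_iff_tendsto,
    ← tendsto_add_atTop_iff_nat (f := fun n => maxSum T F n z) 1]
  constructor
  · intro h
    exact tendsto_atTop_mono (fun n => le_max_right _ _) (tendsto_atTop_add_const_left _ (F z) h)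
  · intro h
    have h1 : ∀ᶠ n in atTop, maxSum T F (n + 1) z + -F z = maxSum T F n (T z) := by
      filter_upwards [h.eventually_gt_atTop 0] with n hn
      have : maxSum T F (n + 1) z = max 0 (F z + maxSum T F n (T z)) := rfl
      rw [this] at hn ⊢
      rw [max_eq_right ((lt_max_iff.1 hn).resolve_left (lt_irrefl _)).le]
      ring
    exact (tendsto_atTop_add_const_right _ (-F z) h : Tendsto (fun n => maxSum T F (n + 1) z + -F z) atTop
      atTop).congr' h1

variable [MeasurableSpace Z]

lemma measurable_maxSum {T : Z → Z} (hT : Measurable T) {F : Z → ℝ} (hF : Measurable F) (n : ℕ) :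
    Measurable (maxSum T F n) := by
  induction n with
  | zero => exact measurable_const
  | succ n ih => exact measurable_const.max (hF.add (ih.comp hT))

lemma measurableSet_unboundedSet {T : Z → Z} (hT : Measurable T) {F : Z → ℝ} (hF : Measurable F) :
    MeasurableSet (unboundedSet T F) := by
  have : unboundedSet T F = ⋂ C : ℕ, ⋃ n, {z | (C : ℝ) < maxSum T F n z} := by
    ext z; simp [unboundedSet]
  rw [this]
  exact .iInter fun C => .iUnion fun n => measurableSet_lt measurable_const (measurable_maxSum hT hF n)

/-- The integral of a bounded function over the set where its Birkhoff sums are unbounded above is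
nonnegative. -/
theorem setIntegral_unboundedSet_nonneg {Q : Measure Z} [IsProbabilityMeasure Q] {T : Z → Z}
    (hT : MeasurePreserving T Q Q) {F : Z → ℝ} (hF : Measurable F) {C : ℝ}
    (hC : ∀ z, |F z| ≤ C) : 0 ≤ ∫ z in unboundedSet T F, F z ∂Q := by
  set A := unboundedSet T F with hA
  have mA : MeasurableSet A := measurableSet_unboundedSet hT.measurable hF
  have mM := measurable_maxSum hT.measurable hF
  have iM : ∀ n, Integrable (maxSum T F n) (Q.restrict A) := fun n =>
    Integrable.of_bound (mM n).aestronglyMeasurable (n * C) (ae_of_all _ fun z => by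
      rw [Real.norm_eq_abs, abs_of_nonneg (maxSum_nonneg T F n z)]; exact maxSum_le hC n z)
  have iMT : ∀ n, Integrable (fun z => maxSum T F n (T z)) (Q.restrict A) := fun n =>
    Integrable.of_bound ((mM n).comp hT.measurable).aestronglyMeasurable (n * C)
      (ae_of_all _ fun z => by
        rw [Real.norm_eq_abs, abs_of_nonneg (maxSum_nonneg T F n _)]; exact maxSum_le hC n _)
  -- Invariance of `A` lets `T` preserve the restricted measure, so that composing with `T` does not
  -- change integrals over `A`.
  have hTA : MeasurePreserving T (Q.restrict A) (Q.restrict A) := by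
    have := hT.restrict_preimage mA
    rwa [hA, preimage_unboundedSet, ← hA] at this
  have hshift : ∀ n, ∫ z in A, maxSum T F n (T z) ∂Q = ∫ z in A, maxSum T F n z ∂Q := fun n => by
    conv_rhs => rw [← hTA.map_eq]
    rw [integral_map hT.measurable.aemeasurable (mM n).aestronglyMeasurable]
  have hpos : ∀ n, 0 ≤ ∫ z in A, (maxSum T F (n + 1) z - maxSum T F n (T z)) ∂Q := fun n => by
    rw [integral_sub (iM _) (iMT _), hshift, sub_nonneg]
    exact integral_mono (iM _) (iM _) fun z => maxSum_le_succ T F n z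
  -- The difference is bounded by `C` everywhere, and at each point of `A` it equals `F z` for all
  -- large `n`, because the maximum with `0` is then inactive.
  have hlim : Tendsto (fun n => ∫ z in A, (maxSum T F (n + 1) z - maxSum T F n (T z)) ∂Q) atTop
      (𝓝 (∫ z in A, F z ∂Q)) := by
    refine tendsto_integral_of_dominated_convergence (fun _ => C)
      (fun n => ((mM _).sub ((mM n).comp hT.measurable)).aestronglyMeasurable)
      (integrable_const _) (fun n => ae_of_all _ fun z => ?_) ?_
    · have h1 := abs_le.1 (hC z)
      have h2 := maxSum_nonneg T F n (T z)
      have : maxSum T F (n + 1) z = max 0 (F z + maxSum T F n (T z)) := rfl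
      rw [Real.norm_eq_abs, this, abs_le]
      have h0 : 0 ≤ C := (abs_nonneg _).trans (hC z)
      constructor
      · have := le_max_right 0 (F z + maxSum T F n (T z)); linarith
      · rw [sub_le_iff_le_add]; exact max_le (by linarith) (by linarith)
    · filter_upwards [ae_restrict_mem mA] with z hz
      have h : Tendsto (fun n => maxSum T F (n + 1) z) atTop atTop :=
        (tendsto_add_atTop_iff_nat 1).2 (mem_unboundedSet_iff_tendsto.1 hz)
      refine tendsto_const_nhds.congr' ?_
      filter_upwards [h.eventually_gt_atTop 0] with n hn
      have : maxSum T F (n + 1) z = max 0 (F z + maxSum T F n (T z)) := rfl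
      rw [this] at hn ⊢
      rw [max_eq_right ((lt_max_iff.1 hn).resolve_left (lt_irrefl _)).le]
      ring
  exact ge_of_tendsto' hlim hpos

end Maximal

/-! ### The law of large numbers for a chain from every starting point -/

section LLN

variable {S : Type*}

/-- The average of the first `n` values of `φ` along `z`. -/
def timeAverage (φ : S → ℝ) (n : ℕ) (z : ℕ → S) : ℝ := (n : ℝ)⁻¹ * ∑ i ∈ Finset.range n, φ (z i)

/-- The two sums differ only by `φ (z n) - φ (z 0)`, which is at most `2 * C`. -/
lemma tendsto_timeAverage_shift {φ : S → ℝ} {C : ℝ} (hC : ∀ s, |φ s| ≤ C) {c : ℝ} (z : ℕ → S) :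
    Tendsto (fun n => timeAverage φ n (shift z)) atTop (𝓝 c) ↔
      Tendsto (fun n => timeAverage φ n z) atTop (𝓝 c) := by
  refine tendsto_iff_of_dist ?_
  have h1 : Tendsto (fun n : ℕ => (n : ℝ)⁻¹ * (2 * C)) atTop (𝓝 0) := by
    simpa using (tendsto_inv_atTop_nhds_zero_nat (𝕜 := ℝ)).mul_const (2 * C)
  refine squeeze_zero (fun n => dist_nonneg) (fun n => ?_) h1
  have h2 : ∑ i ∈ Finset.range n, φ (shift z i) =
      ∑ i ∈ Finset.range n, φ (z i) + (φ (z n) - φ (z 0)) := by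
    have e1 := Finset.sum_range_succ (fun i => φ (z i)) n
    have e2 := Finset.sum_range_succ' (fun i => φ (z i)) n
    simp only [shift]; linarith
  rw [Real.dist_eq, timeAverage, timeAverage, h2, mul_add, add_sub_cancel_left, abs_mul,
    abs_of_nonneg (by positivity : (0 : ℝ) ≤ (n : ℝ)⁻¹)]
  gcongr
  have := abs_le.1 (hC (z n))
  have := abs_le.1 (hC (z 0))
  exact abs_le.2 ⟨by linarith, by linarith⟩

lemma tendsto_timeAverage_add {φ : S → ℝ} {C : ℝ} (hC : ∀ s, |φ s| ≤ C) {c : ℝ} (b : ℕ)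
    (z : ℕ → S) (h : Tendsto (fun n => timeAverage φ n z) atTop (𝓝 c)) :
    Tendsto (fun n => timeAverage φ n fun i => z (b + i)) atTop (𝓝 c) := by
  induction b with
  | zero => simpa using h
  | succ b ih =>
    rw [← tendsto_timeAverage_shift hC] at ih
    refine ih.congr fun n => ?_
    simp only [timeAverage, shift]
    congr! 4 with i
    omega

lemma birkhoffSum_shift (f : S → ℝ) (n : ℕ) (z : ℕ → S) :
    birkhoffSum shift (fun z => f (z 0)) n z = ∑ i ∈ Finset.range n, f (z i) := by
  have h : ∀ (i : ℕ) (z : ℕ → S) (j : ℕ), shift^[i] z j = z (j + i) := by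
    intro i
    induction i with
    | zero => intro z j; rfl
    | succ i ih => intro z j; rw [Function.iterate_succ_apply, ih]; simp only [shift]; congr 1
  simp [birkhoffSum, h]

variable [MeasurableSpace S]

lemma measurable_timeAverage {φ : S → ℝ} (hφ : Measurable φ) (n : ℕ) :
    Measurable (timeAverage φ n) := by
  unfold timeAverage; fun_prop

lemma integral_bind {T : Type*} [MeasurableSpace T] {μ : Measure S} [SFinite μ] {κ : Kernel S T}
    [IsSFiniteKernel κ] {f : T → ℝ} (hf : Integrable f (μ.bind κ)) :
    ∫ t, f t ∂μ.bind κ = ∫ s, ∫ t, f t ∂κ s ∂μ := by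
  have h : (κ ∘ₖ Kernel.const Unit μ) () = μ.bind κ := by
    rw [Kernel.comp_apply, Kernel.const_apply]
  rw [← h, Kernel.integral_comp (by rwa [h]), Kernel.const_apply]

/-- Condition on the first step: the probability of a shift-invariant event is a harmonic function
of the starting point. -/
lemma pathKernel_eq_lintegral (κ : Kernel S S) [IsMarkovKernel κ] {A : Set (ℕ → S)}
    (hA : MeasurableSet A) (hinv : shift ⁻¹' A = A) (s : S) :
    pathKernel κ s A = ∫⁻ t, pathKernel κ t A ∂κ s := by
  conv_lhs => rw [← hinv, ← Measure.map_apply measurable_shift hA, pathKernel_map_shift,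
    Measure.bind_apply hA (Kernel.aemeasurable _)]

/-- Bounded harmonic functions are almost surely constant. -/
lemma ae_eq_const_of_harmonic {κ : Kernel S S} [IsMarkovKernel κ] {π : Measure S}
    [IsProbabilityMeasure π] (hinv : κ.Invariant π) (hac : ∀ s, π ≪ κ s) {h : S → ℝ}
    (hm : Measurable h) {C : ℝ} (hC : ∀ s, |h s| ≤ C) (hh : ∀ s, ∫ t, h t ∂κ s = h s) :
    ∃ c, ∀ᵐ s ∂π, h s = c := by
  have ib : ∀ (μ : Measure S) [IsProbabilityMeasure μ], Integrable h μ := fun μ _ =>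
    Integrable.of_bound hm.aestronglyMeasurable C (ae_of_all _ hC)
  have hC2 : ∀ s, |h s ^ 2| ≤ C ^ 2 := fun s => by
    rw [abs_pow]; exact pow_le_pow_left₀ (abs_nonneg _) (hC s) 2
  have ib2 : ∀ (μ : Measure S) [IsProbabilityMeasure μ], Integrable (fun s => h s ^ 2) μ :=
    fun μ _ => Integrable.of_bound (hm.pow_const 2).aestronglyMeasurable (C ^ 2) (ae_of_all _ hC2)
  have e1 : ∀ s, ∫ t, (h t - h s) ^ 2 ∂κ s = ∫ t, h t ^ 2 ∂κ s - h s ^ 2 := fun s => by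
    have : ∀ t, (h t - h s) ^ 2 = h t ^ 2 - ((2 * h s) * h t - h s ^ 2) := fun t => by ring
    simp_rw [this]
    rw [integral_sub (g := fun t => (2 * h s) * h t - h s ^ 2) (ib2 _)
        (((ib _).const_mul _).sub (integrable_const _)),
      integral_sub ((ib _).const_mul _) (integrable_const _), integral_const_mul, hh]
    simp; ring
  have ik : Integrable (fun s => ∫ t, h t ^ 2 ∂κ s) π :=
    Integrable.of_bound (Measurable.stronglyMeasurable (by fun_prop) |>.integral_kernel
      |>.aestronglyMeasurable) (C ^ 2) (ae_of_all _ fun s => by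
        refine (norm_integral_le_of_norm_le_const (ae_of_all _ hC2)).trans (by simp))
  -- By harmonicity the inner integral is the conditional variance of one step. Its mean vanishes
  -- because `h` has the same second moment before and after a step under the invariant law.
  have e2 : ∫ s, (∫ t, (h t - h s) ^ 2 ∂κ s) ∂π = 0 := by
    simp_rw [e1]
    rw [integral_sub ik (ib2 _)]
    have : ∫ s, (∫ t, h t ^ 2 ∂κ s) ∂π = ∫ s, h s ^ 2 ∂π := by
      conv_rhs => rw [← hinv.def]
      rw [integral_bind]
      rw [hinv.def]; exact ib2 _
    rw [this, sub_self]
  have e3 : (fun s => ∫ t, (h t - h s) ^ 2 ∂κ s) =ᵐ[π] 0 := by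
    refine (integral_eq_zero_iff_of_nonneg (fun s => integral_nonneg fun t => sq_nonneg _) ?_).1 e2
    simp_rw [e1]
    exact ik.sub (ib2 _)
  -- One state with zero conditional variance suffices: `h = h s` holds a.e. for `κ s`, and `κ s`
  -- dominates `π`.
  obtain ⟨s, hs⟩ := e3.exists
  refine ⟨h s, (hac s) ?_⟩
  have : (fun t => (h t - h s) ^ 2) =ᵐ[κ s] 0 :=
    (integral_eq_zero_iff_of_nonneg (fun t => sq_nonneg _) (Integrable.of_bound
      ((hm.sub_const _).pow_const 2).aestronglyMeasurable ((2 * C) ^ 2) (ae_of_all _ fun t => by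
        rw [Real.norm_eq_abs, abs_pow]
        refine pow_le_pow_left₀ (abs_nonneg _) ?_ 2
        have := abs_le.1 (hC t)
        have := abs_le.1 (hC s)
        exact abs_le.2 ⟨by linarith, by linarith⟩))).1 hs
  filter_upwards [this] with t ht
  exact sub_eq_zero.1 (pow_eq_zero_iff two_ne_zero |>.1 ht)

/-- The event `A` of unbounded sums has the same probability `c` from `π`-almost every start, so the
nonnegative integral over `A` is `c * ∫ f`. With `∫ f < 0` this forces `c = 0`. -/
lemma ae_bddAbove_sum {κ : Kernel S S} [IsMarkovKernel κ] {π : Measure S}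
    [IsProbabilityMeasure π] (hinv : κ.Invariant π) (hac : ∀ s, π ≪ κ s) {f : S → ℝ}
    (hf : Measurable f) {C : ℝ} (hC : ∀ s, |f s| ≤ C) (hneg : ∫ s, f s ∂π < 0) :
    ∀ᵐ z ∂chainLaw κ π, ∃ M : ℕ, ∀ n, ∑ i ∈ Finset.range n, f (z i) ≤ M := by
  set F : (ℕ → S) → ℝ := fun z => f (z 0) with hF
  have mF : Measurable F := hf.comp (measurable_pi_apply 0)
  set A := unboundedSet shift F with hA
  have mA : MeasurableSet A := measurableSet_unboundedSet measurable_shift mF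
  have h0 : 0 ≤ ∫ z in A, F z ∂chainLaw κ π :=
    setIntegral_unboundedSet_nonneg (measurePreserving_shift hinv) mF (C := C) fun z => hC _
  set h : S → ℝ := fun s => (pathKernel κ s).real A with hh
  have mh : Measurable h := (Kernel.measurable_coe _ mA).ennreal_toReal
  obtain ⟨c, hc⟩ := ae_eq_const_of_harmonic hinv hac mh (C := 1)
    (fun s => by rw [abs_of_nonneg measureReal_nonneg]; exact measureReal_le_one)
    (fun s => by
      simp only [hh, Measure.real]
      rw [integral_toReal (Kernel.measurable_coe _ mA).aemeasurable
        (ae_of_all _ fun t => measure_lt_top _ _),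
        ← pathKernel_eq_lintegral κ mA (preimage_unboundedSet _ _)])
  have e1 : ∫ z in A, F z ∂chainLaw κ π = ∫ s, f s * h s ∂π := by
    rw [← integral_indicator mA, chainLaw_eq_bind, integral_bind]
    · refine integral_congr_ae (ae_of_all _ fun s => ?_)
      have : ∀ᵐ z ∂pathKernel κ s, A.indicator F z = A.indicator (fun _ => f s) z := by
        -- The path starts at `s`, but singletons need not be measurable, so the level set of `f` is
        -- used instead.
        filter_upwards [pathKernel_ae_zero κ (s := s) (A := {t | f t = f s})
          (measurableSet_eq_fun hf measurable_const) rfl] with z hz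
        by_cases hzA : z ∈ A
        · simp only [Set.indicator_of_mem hzA]; exact hz
        · simp only [Set.indicator_of_notMem hzA]
      simp only
      rw [integral_congr_ae this, integral_indicator_const _ mA, smul_eq_mul, mul_comm]
    · rw [← chainLaw_eq_bind]
      exact (Integrable.of_bound mF.aestronglyMeasurable C (ae_of_all _ fun z => hC _)).indicator mA
  have e2 : ∫ s, f s * h s ∂π = (∫ s, f s ∂π) * c := by
    rw [← integral_mul_const]
    exact integral_congr_ae (hc.mono fun s hs => by simp only [hs])
  have hc0 : c = 0 := by
    rw [e1, e2] at h0
    obtain ⟨s, hs⟩ := hc.exists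
    have : 0 ≤ c := hs ▸ measureReal_nonneg
    nlinarith
  have hA0 : chainLaw κ π A = 0 := by
    rw [chainLaw_eq_bind, Measure.bind_apply mA (Kernel.aemeasurable _), lintegral_eq_zero_iff
      (Kernel.measurable_coe _ mA)]
    filter_upwards [hc] with s hs
    rw [hc0] at hs
    exact (measureReal_eq_zero_iff).1 hs
  filter_upwards [measure_eq_zero_iff_ae_notMem.1 hA0] with z hz
  simp only [hA, unboundedSet, Set.mem_ofPred_eq, not_forall, not_exists, not_lt] at hz
  obtain ⟨M, hM⟩ := hz
  refine ⟨M, fun n => ?_⟩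
  rw [← birkhoffSum_shift]
  exact (birkhoffSum_le_maxSum _ _ n z).trans (hM n)

lemma ae_eventually_timeAverage_le {κ : Kernel S S} [IsMarkovKernel κ] {π : Measure S}
    [IsProbabilityMeasure π] (hinv : κ.Invariant π) (hac : ∀ s, π ≪ κ s) {φ : S → ℝ}
    (hφ : Measurable φ) {C : ℝ} (hC : ∀ s, |φ s| ≤ C) {ε : ℝ} (hε : 0 < ε) :
    ∀ᵐ z ∂chainLaw κ π, ∀ᶠ n in atTop, timeAverage φ n z ≤ ∫ s, φ s ∂π + ε := by
  set c := ∫ s, φ s ∂π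
  have iφ : Integrable φ π := Integrable.of_bound hφ.aestronglyMeasurable C (ae_of_all _ hC)
  -- The shifted function has mean `-ε / 2`. Its sums stay below some `M`, and `M / n` is eventually
  -- smaller than the remaining `ε / 2`.
  have := ae_bddAbove_sum hinv hac (f := fun s => φ s - (c + ε / 2)) (hφ.sub_const _)
    (C := C + |c + ε / 2|) (fun s => (abs_sub _ _).trans (by gcongr; exact hC s)) (by
      rw [integral_sub iφ (integrable_const _)]
      simp only [integral_const, probReal_univ, one_smul]
      linarith)
  filter_upwards [this] with z ⟨M, hM⟩
  have h1 : Tendsto (fun n : ℕ => (n : ℝ)⁻¹ * M) atTop (𝓝 0) := by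
    simpa using (tendsto_inv_atTop_nhds_zero_nat (𝕜 := ℝ)).mul_const (M : ℝ)
  filter_upwards [h1.eventually_lt_const (half_pos hε), eventually_gt_atTop 0] with n hn hn0
  have hn0' : (0 : ℝ) < n := by exact_mod_cast hn0
  have h2 := hM n
  rw [Finset.sum_sub_distrib] at h2
  simp only [Finset.sum_const, Finset.card_range, nsmul_eq_mul] at h2
  have h3 : timeAverage φ n z ≤ (n : ℝ)⁻¹ * (M + n * (c + ε / 2)) := by
    unfold timeAverage; gcongr; linarith
  rw [mul_add, inv_mul_cancel_left₀ hn0'.ne'] at h3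
  linarith

/-- The one-sided bound for `φ` and for `-φ`, along countably many tolerances. -/
lemma ae_tendsto_timeAverage_stationary {κ : Kernel S S} [IsMarkovKernel κ] {π : Measure S}
    [IsProbabilityMeasure π] (hinv : κ.Invariant π) (hac : ∀ s, π ≪ κ s) {φ : S → ℝ}
    (hφ : Measurable φ) {C : ℝ} (hC : ∀ s, |φ s| ≤ C) :
    ∀ᵐ z ∂chainLaw κ π, Tendsto (fun n => timeAverage φ n z) atTop (𝓝 (∫ s, φ s ∂π)) := by
  have h1 : ∀ᵐ z ∂chainLaw κ π, ∀ k : ℕ, ∀ᶠ n in atTop,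
      timeAverage φ n z ≤ ∫ s, φ s ∂π + ((k : ℝ) + 1)⁻¹ :=
    ae_all_iff.2 fun k => ae_eventually_timeAverage_le hinv hac hφ hC (by positivity)
  have h2 : ∀ᵐ z ∂chainLaw κ π, ∀ k : ℕ, ∀ᶠ n in atTop,
      timeAverage (fun s => -φ s) n z ≤ ∫ s, -φ s ∂π + ((k : ℝ) + 1)⁻¹ :=
    ae_all_iff.2 fun k => ae_eventually_timeAverage_le hinv hac (φ := fun s => -φ s) hφ.neg (C := C)
      (fun s => by rw [abs_neg]; exact hC s) (by positivity)
  filter_upwards [h1, h2] with z hz1 hz2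
  rw [Metric.tendsto_nhds]
  intro ε hε
  obtain ⟨k, hk⟩ := exists_nat_one_div_lt hε
  rw [one_div] at hk
  filter_upwards [hz1 k, hz2 k] with n hn1 hn2
  rw [integral_neg] at hn2
  have : timeAverage (fun s => -φ s) n z = -timeAverage φ n z := by
    simp [timeAverage]
  rw [Real.dist_eq, abs_lt]
  constructor <;> linarith

/-- The law of large numbers, from every starting point, for a chain which from every state either
moves according to a law equivalent to `π` or stays. -/
theorem ae_tendsto_timeAverage {κ : Kernel S S} [IsMarkovKernel κ] {π : Measure S}
    [IsProbabilityMeasure π] (hinv : κ.Invariant π)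
    (hκ : ∀ s, ∃ (a : Measure S) (r : ENNReal), κ s = a + r • Measure.dirac s ∧ a ≪ π ∧ π ≪ a)
    {φ : S → ℝ} (hφ : Measurable φ) {C : ℝ} (hC : ∀ s, |φ s| ≤ C) (s : S) :
    ∀ᵐ z ∂pathKernel κ s, Tendsto (fun n => timeAverage φ n z) atTop (𝓝 (∫ s, φ s ∂π)) := by
  have hac : ∀ s, π ≪ κ s := fun s => by
    obtain ⟨a, r, h1, -, h2⟩ := hκ s
    rw [h1]
    exact h2.trans (Measure.absolutelyContinuous_of_le (Measure.le_add_right le_rfl))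
  set E : Set (ℕ → S) :=
    {z | Tendsto (fun n => timeAverage φ n z) atTop (𝓝 (∫ s, φ s ∂π))} with hE
  have mE : MeasurableSet Eᶜ :=
    (measurableSet_tendsto (𝓝 (∫ s, φ s ∂π)) (measurable_timeAverage hφ)).compl
  have hEinv : shift ⁻¹' Eᶜ = Eᶜ := by
    ext z
    simp only [hE, Set.mem_preimage, Set.mem_compl_iff, Set.mem_ofPred_eq,
      tendsto_timeAverage_shift hC]
  have h0 : ∀ᵐ t ∂π, pathKernel κ t Eᶜ = 0 := by
    have h := ae_tendsto_timeAverage_stationary hinv hac hφ hC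
    have h' : chainLaw κ π Eᶜ = 0 := h
    rwa [chainLaw_eq_bind, Measure.bind_apply mE (Kernel.aemeasurable _), lintegral_eq_zero_iff
      (Kernel.measurable_coe _ mE)] at h'
  obtain ⟨a, r, h1, h2, h3⟩ := hκ s
  change pathKernel κ s Eᶜ = 0
  have mk : Measurable fun t => pathKernel κ t Eᶜ := Kernel.measurable_coe _ mE
  -- The failure probability `v` vanishes `π`-a.e., hence `a`-a.e. The first-step equation therefore
  -- reduces to `v s = r * v s`.
  have h4 := pathKernel_eq_lintegral κ mE hEinv s
  rw [h1, lintegral_add_measure, lintegral_smul_measure, lintegral_dirac' _ mk,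
    lintegral_congr_ae (h2.ae_le h0), lintegral_zero, zero_add] at h4
  -- Since `π ≪ a`, the moving part `a` is nonzero and leaves less than mass one for staying.
  have hr : r < 1 := by
    have ha : a Set.univ ≠ 0 := fun h => by simpa using h3 h
    have hu : κ s Set.univ = 1 := measure_univ
    rw [h1] at hu
    simp only [Measure.coe_add, Pi.add_apply, Measure.smul_apply, measure_univ, smul_eq_mul,
      mul_one] at hu
    rw [← hu]
    rw [add_comm]
    exact ENNReal.lt_add_right (by rintro rfl; simp at hu) ha
  by_contra hne
  have hlt : r * pathKernel κ s Eᶜ < 1 * pathKernel κ s Eᶜ :=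
    ENNReal.mul_lt_mul_left hne (measure_ne_top _ _) hr
  rw [one_mul] at hlt
  exact absurd h4 (by simpa using hlt.ne')

/-- Such a chain has only one stationary distribution. -/
theorem eq_of_invariant {κ : Kernel S S} [IsMarkovKernel κ] {π : Measure S}
    [IsProbabilityMeasure π] (hinv : κ.Invariant π)
    (hκ : ∀ s, ∃ (a : Measure S) (r : ENNReal), κ s = a + r • Measure.dirac s ∧ a ≪ π ∧ π ≪ a)
    {μ : Measure S} [IsProbabilityMeasure μ] (hμ : κ.Invariant μ) : μ = π := by
  ext B hB
  set φ : S → ℝ := B.indicator 1 with hφ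
  have mφ : Measurable φ := measurable_one.indicator hB
  have hC : ∀ s, |φ s| ≤ 1 := fun s => by
    by_cases hs : s ∈ B <;> simp [hφ, hs]
  have hae : ∀ᵐ z ∂chainLaw κ μ, Tendsto (fun n => timeAverage φ n z) atTop (𝓝 (∫ s, φ s ∂π)) := by
    have mE : MeasurableSet {z | Tendsto (fun n => timeAverage φ n z) atTop (𝓝 (∫ s, φ s ∂π))}ᶜ :=
      (measurableSet_tendsto (𝓝 (∫ s, φ s ∂π)) (measurable_timeAverage mφ)).compl
    change chainLaw κ μ {z | Tendsto (fun n => timeAverage φ n z) atTop (𝓝 (∫ s, φ s ∂π))}ᶜ = 0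
    rw [chainLaw_eq_bind, Measure.bind_apply mE (Kernel.aemeasurable _)]
    rw [lintegral_congr fun s => (ae_tendsto_timeAverage hinv hκ mφ hC s : _ = _), lintegral_zero]
  have hbd : ∀ n z, ‖timeAverage φ n z‖ ≤ 1 := fun n z => by
    rw [Real.norm_eq_abs, timeAverage, abs_mul, abs_of_nonneg (by positivity : (0 : ℝ) ≤ (n : ℝ)⁻¹)]
    calc (n : ℝ)⁻¹ * |∑ i ∈ Finset.range n, φ (z i)|
        ≤ (n : ℝ)⁻¹ * ∑ i ∈ Finset.range n, (1 : ℝ) := by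
          gcongr; exact (Finset.abs_sum_le_sum_abs _ _).trans (Finset.sum_le_sum fun i _ => hC _)
      _ ≤ 1 := by simpa using inv_mul_le_one
  have hlim := tendsto_integral_of_dominated_convergence (μ := chainLaw κ μ) (fun _ => (1 : ℝ))
    (fun n => (measurable_timeAverage mφ n).aestronglyMeasurable) (integrable_const _)
    (fun n => ae_of_all _ (hbd n)) hae
  -- Under the stationary law `μ` every term has mean `∫ φ ∂μ`; `n = 0` is excluded because the
  -- empty average is `0`.
  have hconst : ∀ᶠ n : ℕ in atTop, ∫ z, timeAverage φ n z ∂chainLaw κ μ = ∫ s, φ s ∂μ := by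
    filter_upwards [eventually_gt_atTop 0] with n hn
    have hn0' : (n : ℝ) ≠ 0 := by exact_mod_cast hn.ne'
    simp only [timeAverage]
    rw [integral_const_mul, integral_finsetSum]
    · have : ∀ i, ∫ z, φ (z i) ∂chainLaw κ μ = ∫ s, φ s ∂μ := fun i => by
        conv_rhs => rw [← chainLaw_map_eval hμ i]
        rw [integral_map (measurable_pi_apply i).aemeasurable mφ.aestronglyMeasurable]
      simp [this, hn0']
    · intro i _
      exact Integrable.of_bound (mφ.comp (measurable_pi_apply i)).aestronglyMeasurable 1
        (ae_of_all _ fun z => hC _)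
  have := tendsto_nhds_unique hlim (tendsto_const_nhds.congr' (hconst.mono fun n h => h.symm))
  simp only [integral_const, probReal_univ, one_smul, hφ, integral_indicator_one hB] at this
  exact ((measureReal_eq_measureReal_iff).1 this).symm

end LLN

/-! ### The Metropolis-Hastings step -/

section MH

variable {X Y Θ : Type*} [TopologicalSpace X] [MeasurableSpace X] [MeasurableSpace Y]
  [TopologicalSpace Θ] [MeasurableSpace Θ]

/-- A regular model with a full proposal, all of whose ingredients are jointly measurable. -/
structure IsMeasurableModel (lX : Measure X) (lT : Measure Θ) (u : X → Θ → ℝ)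
    (p : X → Y → Θ → ℝ) (g : X → X → ℝ) : Prop where
  measurable_utility : Measurable fun z : X × Θ => u z.1 z.2
  measurable_density : Measurable fun z : X × Y × Θ => p z.1 z.2.1 z.2.2
  regular : IsRegularModel lT u p
  proposal : IsFullProposal lX g

variable {lX : Measure X} [IsFiniteMeasure lX] {ν : Measure Y} [IsProbabilityMeasure ν]
  {lT : Measure Θ} [SigmaFinite lT] {u : X → Θ → ℝ} {p : X → Y → Θ → ℝ} {g : X → X → ℝ}

lemma acceptProb_nonneg (hu : ∀ x θ, 0 < u x θ) (hg : ∀ x' x, 0 < g x' x) (s' s : X × Y × Θ) :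
    0 ≤ acceptProb u g s' s :=
  le_min zero_le_one (div_nonneg (mul_pos (hu _ _) (hg _ _)).le (mul_pos (hu _ _) (hg _ _)).le)

lemma acceptProb_pos (hu : ∀ x θ, 0 < u x θ) (hg : ∀ x' x, 0 < g x' x) (s' s : X × Y × Θ) :
    0 < acceptProb u g s' s :=
  lt_min one_pos (div_pos (mul_pos (hu _ _) (hg _ _)) (mul_pos (hu _ _) (hg _ _)))

lemma acceptProb_le_one (s' s : X × Y × Θ) : acceptProb u g s' s ≤ 1 := min_le_left _ _

/-- The environment is kept as a parameter, so that the same lemma serves the Attacker's kernel and,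
with `Ω = Unit`, a single model. -/
lemma measurable_acceptProb {Ω : Type*} [MeasurableSpace Ω] {U : Ω → X → Θ → ℝ}
    (mU : Measurable fun z : Ω × X × Θ => U z.1 z.2.1 z.2.2)
    (mg : Measurable fun z : X × X => g z.1 z.2) :
    Measurable fun w : (Ω × X × Y × Θ) × X × Y × Θ => acceptProb (U w.1.1) g w.1.2 w.2 := by
  unfold acceptProb
  have h1 : Measurable fun w : (Ω × X × Y × Θ) × X × Y × Θ => U w.1.1 w.2.1 w.2.2.2 :=
    mU.comp (f := fun w : (Ω × X × Y × Θ) × X × Y × Θ => (w.1.1, w.2.1, w.2.2.2)) (by fun_prop)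
  have h2 : Measurable fun w : (Ω × X × Y × Θ) × X × Y × Θ => U w.1.1 w.1.2.1 w.1.2.2.2 :=
    mU.comp (f := fun w : (Ω × X × Y × Θ) × X × Y × Θ => (w.1.1, w.1.2.1, w.1.2.2.2)) (by fun_prop)
  have h3 : Measurable fun w : (Ω × X × Y × Θ) × X × Y × Θ => g w.2.1 w.1.2.1 :=
    mg.comp (f := fun w : (Ω × X × Y × Θ) × X × Y × Θ => (w.2.1, w.1.2.1)) (by fun_prop)
  have h4 : Measurable fun w : (Ω × X × Y × Θ) × X × Y × Θ => g w.1.2.1 w.2.1 :=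
    mg.comp (f := fun w : (Ω × X × Y × Θ) × X × Y × Θ => (w.1.2.1, w.2.1)) (by fun_prop)
  exact measurable_const.min ((h1.mul h3).div (h2.mul h4))

/-! ### Total mass, detailed balance and equivalence of measures for one step -/

namespace IsMeasurableModel

variable (h : IsMeasurableModel lX lT u p g)
include h

lemma measurable_accept :
    Measurable fun w : (X × Y × Θ) × X × Y × Θ => acceptProb u g w.1 w.2 :=
  (measurable_acceptProb (Ω := Unit) (U := fun _ => u)
    (h.measurable_utility.comp (f := fun z : Unit × X × Θ => z.2) (by fun_prop))
    h.proposal.measurable).comp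
    (f := fun w : (X × Y × Θ) × X × Y × Θ => (((), w.1), w.2)) (by fun_prop)

lemma measurable_candidate : Measurable fun w : (X × Y × Θ) × X × Y × Θ =>
    ENNReal.ofReal (g w.1.1 w.2.1 * p w.2.1 w.2.2.1 w.2.2.2) :=
  ((h.proposal.measurable.comp (f := fun w : (X × Y × Θ) × X × Y × Θ => (w.1.1, w.2.1))
    (by fun_prop)).mul (h.measurable_density.comp measurable_snd)).ennreal_ofReal

lemma measurable_weight : Measurable fun s : X × Y × Θ =>
    ENNReal.ofReal (u s.1 s.2.2 * p s.1 s.2.1 s.2.2) :=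
  ((h.measurable_utility.comp (f := fun s : X × Y × Θ => (s.1, s.2.2)) (by fun_prop)).mul
    h.measurable_density).ennreal_ofReal

lemma measurable_accept_right (s' : X × Y × Θ) :
    Measurable fun s : X × Y × Θ => ENNReal.ofReal (acceptProb u g s' s) :=
  (h.measurable_accept.comp measurable_prodMk_left).ennreal_ofReal

lemma measurable_candidate_right (s' : X × Y × Θ) : Measurable fun s : X × Y × Θ =>
    ENNReal.ofReal (g s'.1 s.1 * p s.1 s.2.1 s.2.2) :=
  h.measurable_candidate.comp measurable_prodMk_left

lemma measurable_density_right (x : X) :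
    Measurable fun t : Y × Θ => ENNReal.ofReal (p x t.1 t.2) :=
  (h.measurable_density.comp (measurable_prodMk_left (x := x))).ennreal_ofReal

lemma lintegral_density (x : X) :
    ∫⁻ t, ENNReal.ofReal (p x t.1 t.2) ∂ν.prod lT = 1 := by
  rw [lintegral_prod _ (h.measurable_density_right x).aemeasurable]
  simp [h.regular.density_one]

lemma isProbabilityMeasure_candidateLaw (s' : X × Y × Θ) :
    IsProbabilityMeasure (candidateLaw lX ν lT p g s') := by
  constructor
  rw [candidateLaw, withDensity_apply _ .univ, Measure.restrict_univ, lintegral_prod _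
    (h.measurable_candidate_right s').aemeasurable]
  simp_rw [ENNReal.ofReal_mul (h.proposal.pos _ _).le]
  have : ∀ x, ∫⁻ t : Y × Θ, ENNReal.ofReal (g s'.1 x) * ENNReal.ofReal (p x t.1 t.2) ∂ν.prod lT =
      ENNReal.ofReal (g s'.1 x) := fun x => by
    rw [lintegral_const_mul _ (h.measurable_density_right x), h.lintegral_density, mul_one]
  simp_rw [this, h.proposal.density_one]

lemma accept_add_reject (s' : X × Y × Θ) :
    ∫⁻ s, ENNReal.ofReal (acceptProb u g s' s) ∂candidateLaw lX ν lT p g s' +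
      ∫⁻ s, ENNReal.ofReal (1 - acceptProb u g s' s) ∂candidateLaw lX ν lT p g s' = 1 := by
  have := h.isProbabilityMeasure_candidateLaw (ν := ν) s'
  rw [← lintegral_add_left (h.measurable_accept_right s')]
  have : ∀ s : X × Y × Θ, ENNReal.ofReal (acceptProb u g s' s) +
      ENNReal.ofReal (1 - acceptProb u g s' s) = 1 := fun s => by
    rw [← ENNReal.ofReal_add (acceptProb_nonneg h.regular.utility_pos h.proposal.pos s' s)
      (sub_nonneg.2 (acceptProb_le_one s' s))]
    simp
  simp [this]

lemma isProbabilityMeasure_mhStep (s' : X × Y × Θ) :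
    IsProbabilityMeasure (mhStep lX ν lT u p g s') := by
  constructor
  rw [mhStep]
  simp only [Measure.coe_add, Pi.add_apply, Measure.smul_apply, measure_univ, smul_eq_mul, mul_one]
  rw [withDensity_apply _ .univ, Measure.restrict_univ]
  exact h.accept_add_reject s'

lemma lintegral_mhStep (s' : X × Y × Θ) {f : X × Y × Θ → ENNReal} (hf : Measurable f) :
    ∫⁻ s, f s ∂mhStep lX ν lT u p g s' =
      ∫⁻ s, ENNReal.ofReal (acceptProb u g s' s) * f s ∂candidateLaw lX ν lT p g s' +
      (∫⁻ s, ENNReal.ofReal (1 - acceptProb u g s' s) ∂candidateLaw lX ν lT p g s') * f s' := by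
  rw [mhStep, lintegral_add_measure, lintegral_smul_measure, lintegral_dirac' _ hf,
    lintegral_withDensity_eq_lintegral_mul _
      (h.measurable_accept_right s') hf]
  rfl

/-- Detailed balance. -/
lemma weight_mul_candidate_mul_accept (s' s : X × Y × Θ) :
    ENNReal.ofReal (u s'.1 s'.2.2 * p s'.1 s'.2.1 s'.2.2) *
      (ENNReal.ofReal (g s'.1 s.1 * p s.1 s.2.1 s.2.2) * ENNReal.ofReal (acceptProb u g s' s)) =
    ENNReal.ofReal (u s.1 s.2.2 * p s.1 s.2.1 s.2.2) *
      (ENNReal.ofReal (g s.1 s'.1 * p s'.1 s'.2.1 s'.2.2) *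
        ENNReal.ofReal (acceptProb u g s s')) := by
  have hu := h.regular.utility_pos
  have hp := h.regular.density_pos
  have hg := h.proposal.pos
  -- Multiplying the acceptance probability by its denominator turns the flow from `a` to `b` into
  -- an expression symmetric in `a` and `b`.
  have key : ∀ a b : X × Y × Θ, u a.1 a.2.2 * p a.1 a.2.1 a.2.2 *
      (g a.1 b.1 * p b.1 b.2.1 b.2.2 * acceptProb u g a b) =
      p a.1 a.2.1 a.2.2 * p b.1 b.2.1 b.2.2 *
        min (u a.1 a.2.2 * g a.1 b.1) (u b.1 b.2.2 * g b.1 a.1) := fun a b => by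
    have h1 : 0 < u a.1 a.2.2 * g a.1 b.1 := mul_pos (hu _ _) (hg _ _)
    have h2 : (u a.1 a.2.2 * g a.1 b.1) * acceptProb u g a b =
        min (u a.1 a.2.2 * g a.1 b.1) (u b.1 b.2.2 * g b.1 a.1) := by
      rw [acceptProb, mul_min_of_nonneg _ _ h1.le, mul_one, mul_div_cancel₀ _ h1.ne']
    rw [← h2]; ring
  rw [← ENNReal.ofReal_mul (mul_pos (hg _ _) (hp _ _ _)).le,
    ← ENNReal.ofReal_mul (mul_pos (hg _ _) (hp _ _ _)).le,
    ← ENNReal.ofReal_mul (mul_pos (hu _ _) (hp _ _ _)).le,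
    ← ENNReal.ofReal_mul (mul_pos (hu _ _) (hp _ _ _)).le, key, key, min_comm]
  congr 1; ring

/-- Detailed balance turns the accepted flow into a state into the accepted flow out of it; the
latter and the rejected mass add up to one. -/
lemma lintegral_mhStep_unnormalized {f : X × Y × Θ → ENNReal} (hf : Measurable f) :
    ∫⁻ s', ∫⁻ s, f s ∂mhStep lX ν lT u p g s' ∂unnormalizedAugmented lX ν lT u p =
      ∫⁻ s, f s ∂unnormalizedAugmented lX ν lT u p := by
  set ρ := lX.prod (ν.prod lT) with hρ
  set w : X × Y × Θ → ENNReal := fun s => ENNReal.ofReal (u s.1 s.2.2 * p s.1 s.2.1 s.2.2) with hw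
  set q : X × Y × Θ → X × Y × Θ → ENNReal := fun s' s =>
    ENNReal.ofReal (g s'.1 s.1 * p s.1 s.2.1 s.2.2) with hq
  set α : X × Y × Θ → X × Y × Θ → ENNReal := fun s' s => ENNReal.ofReal (acceptProb u g s' s)
  have mw : Measurable w := h.measurable_weight
  have mq : Measurable fun z : (X × Y × Θ) × X × Y × Θ => q z.1 z.2 := h.measurable_candidate
  have mα : Measurable fun z : (X × Y × Θ) × X × Y × Θ => α z.1 z.2 :=
    h.measurable_accept.ennreal_ofReal
  have mβ : Measurable fun z : (X × Y × Θ) × X × Y × Θ =>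
    ENNReal.ofReal (1 - acceptProb u g z.1 z.2) := (h.measurable_accept.const_sub 1).ennreal_ofReal
  have mq' : ∀ s', Measurable (q s') := fun s' => mq.comp measurable_prodMk_left
  have mα' : ∀ s', Measurable (α s') := fun s' => mα.comp measurable_prodMk_left
  have e1 : ∀ s', ∫⁻ s, α s' s * f s ∂candidateLaw lX ν lT p g s' =
      ∫⁻ s, q s' s * (α s' s * f s) ∂ρ := fun s' =>
    lintegral_withDensity_eq_lintegral_mul _ (mq' s') ((mα' s').mul hf)
  have e1' : ∀ s', ∫⁻ s, α s' s ∂candidateLaw lX ν lT p g s' = ∫⁻ s, q s' s * α s' s ∂ρ :=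
    fun s' => lintegral_withDensity_eq_lintegral_mul _ (mq' s') (mα' s')
  have e2 : ∀ s', ∫⁻ s, ENNReal.ofReal (1 - acceptProb u g s' s) ∂candidateLaw lX ν lT p g s' =
      ∫⁻ s, q s' s * ENNReal.ofReal (1 - acceptProb u g s' s) ∂ρ := fun s' =>
    lintegral_withDensity_eq_lintegral_mul _ (mq' s') (mβ.comp measurable_prodMk_left)
  have m1 : Measurable fun s' => ∫⁻ s, q s' s * (α s' s * f s) ∂ρ :=
    (mq.mul (mα.mul (hf.comp measurable_snd))).lintegral_prod_right'
  have m2 : Measurable fun s' => ∫⁻ s, q s' s * ENNReal.ofReal (1 - acceptProb u g s' s) ∂ρ :=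
    (mq.mul mβ).lintegral_prod_right'
  have hsum := fun s' => h.accept_add_reject (ν := ν) s'
  simp only [e2] at hsum
  have hW : ∀ F : X × Y × Θ → ENNReal, Measurable F →
      ∫⁻ s, F s ∂unnormalizedAugmented lX ν lT u p = ∫⁻ s, w s * F s ∂ρ := fun F hF =>
    lintegral_withDensity_eq_lintegral_mul _ mw hF
  have e4 : ∀ s', ∫⁻ s, f s ∂mhStep lX ν lT u p g s' = ∫⁻ s, q s' s * (α s' s * f s) ∂ρ +
      (∫⁻ s, q s' s * ENNReal.ofReal (1 - acceptProb u g s' s) ∂ρ) * f s' := fun s' => by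
    rw [h.lintegral_mhStep _ hf, e2, ← e1]
  rw [lintegral_congr e4, hW (fun s' => ∫⁻ s, q s' s * (α s' s * f s) ∂ρ +
    (∫⁻ s, q s' s * ENNReal.ofReal (1 - acceptProb u g s' s) ∂ρ) * f s') (m1.add (m2.mul hf)),
    hW _ hf]
  simp only [mul_add]
  rw [lintegral_add_left (f := fun s' => w s' * ∫⁻ s, q s' s * (α s' s * f s) ∂ρ) (mw.mul m1)]
  -- Tonelli exchanges the roles of the two states, and detailed balance restores the original order
  -- of the arguments.
  have e3 : ∫⁻ s', w s' * ∫⁻ s, q s' s * (α s' s * f s) ∂ρ ∂ρ =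
      ∫⁻ s', w s' * ((∫⁻ s, q s' s * α s' s ∂ρ) * f s') ∂ρ := by
    calc ∫⁻ s', w s' * ∫⁻ s, q s' s * (α s' s * f s) ∂ρ ∂ρ
        = ∫⁻ s', ∫⁻ s, w s' * (q s' s * (α s' s * f s)) ∂ρ ∂ρ := by
          refine lintegral_congr fun s' => ?_
          exact (lintegral_const_mul _ ((mq' s').mul ((mα' s').mul hf))).symm
      _ = ∫⁻ s', ∫⁻ s, w s * (q s s' * α s s') * f s' ∂ρ ∂ρ := by
          rw [lintegral_lintegral_swap]
          · exact lintegral_congr fun s => lintegral_congr fun s' => by ring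
          · exact ((mw.comp measurable_fst).mul
              (mq.mul (mα.mul (hf.comp measurable_snd)))).aemeasurable
      _ = ∫⁻ s', w s' * ((∫⁻ s, q s' s * α s' s ∂ρ) * f s') ∂ρ := by
          refine lintegral_congr fun s' => ?_
          have : ∀ s, w s * (q s s' * α s s') * f s' = w s' * f s' * (q s' s * α s' s) := fun s => by
            have := h.weight_mul_candidate_mul_accept s s'
            simp only [w, q, α]
            rw [this]; ring
          simp_rw [this]
          refine (lintegral_const_mul _ ((mq' s').mul (mα' s'))).trans ?_
          simp only [Pi.mul_apply]
          ring
  rw [e3, ← lintegral_add_left]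
  · refine lintegral_congr fun s' => ?_
    rw [← mul_add, ← add_mul, ← e1', hsum, one_mul]
  · exact mw.mul ((mq.mul mα).lintegral_prod_right'.mul hf)

lemma invariant {κ : Kernel (X × Y × Θ) (X × Y × Θ)} (hκ : ∀ s, κ s = mhStep lX ν lT u p g s) :
    κ.Invariant (augmented lX ν lT u p) := by
  refine Measure.ext_of_lintegral _ fun f hf => ?_
  rw [Measure.lintegral_bind (Kernel.aemeasurable _) hf.aemeasurable, augmented,
    lintegral_smul_measure, lintegral_smul_measure, ← h.lintegral_mhStep_unnormalized hf]
  simp_rw [hκ]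

/-- Both the accepted part of a step and the augmented distribution have strictly positive densities
with respect to `lX ⊗ ν ⊗ lT`. Finiteness of the total mass keeps the normalising factor away from
zero. -/
lemma absolutelyContinuous_augmented (htop : unnormalizedAugmented lX ν lT u p Set.univ ≠ ⊤) (s : X × Y × Θ) :
    ∃ (a : Measure (X × Y × Θ)) (r : ENNReal), mhStep lX ν lT u p g s = a + r • Measure.dirac s ∧
      a ≪ augmented lX ν lT u p ∧ augmented lX ν lT u p ≪ a := by
  refine ⟨_, _, rfl, ?_, ?_⟩
  · have h1 : lX.prod (ν.prod lT) ≪ unnormalizedAugmented lX ν lT u p :=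
      withDensity_absolutelyContinuous' h.measurable_weight.aemeasurable (ae_of_all _ fun t => by
        simpa using mul_pos (h.regular.utility_pos _ _) (h.regular.density_pos _ _ _))
    have h2 : unnormalizedAugmented lX ν lT u p ≪ augmented lX ν lT u p :=
      Measure.absolutelyContinuous_smul (ENNReal.inv_ne_zero.2 htop)
    exact ((withDensity_absolutelyContinuous _ _).trans
      (withDensity_absolutelyContinuous _ _)).trans (h1.trans h2)
  · have h1 : lX.prod (ν.prod lT) ≪ candidateLaw lX ν lT p g s :=
      withDensity_absolutelyContinuous'
        (h.measurable_candidate_right s).aemeasurable (ae_of_all _ fun t => by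
        simpa using mul_pos (h.proposal.pos _ _) (h.regular.density_pos _ _ _))
    have h2 : candidateLaw lX ν lT p g s ≪ (candidateLaw lX ν lT p g s).withDensity
        (fun t => ENNReal.ofReal (acceptProb u g s t)) :=
      withDensity_absolutelyContinuous'
        (h.measurable_accept_right s).aemeasurable
        (ae_of_all _ fun t => by
          simpa using acceptProb_pos h.regular.utility_pos h.proposal.pos s t)
    exact (Measure.smul_absolutelyContinuous.trans (withDensity_absolutelyContinuous _ _)).trans
      (h1.trans h2)

end IsMeasurableModel

end MH

/-! ### The expected utility and the augmented distribution -/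

section Semicontinuity

variable {X T : Type*} [MetricSpace X] [MeasurableSpace T] {ρ : Measure T}

/-- Fatou's lemma for a parameter integral. -/
lemma lowerSemicontinuous_integral {f : X → T → ℝ} (h0 : ∀ x t, 0 ≤ f x t)
    (hm : ∀ x, Measurable (f x)) (hi : ∀ x, Integrable (f x) ρ)
    (hc : ∀ t, Continuous fun x => f x t) : LowerSemicontinuous fun x => ∫ t, f x t ∂ρ := by
  intro x y hy
  by_contra hcon
  -- Fatou's lemma is about sequences; first countability provides one that converges to `x` and
  -- keeps the integrals at or below `y`.
  have hfr : ∃ᶠ x' in 𝓝 x, ∫ t, f x' t ∂ρ ≤ y := by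
    exact fun hev => hcon (hev.mono fun x' hx' => not_le.1 hx')
  obtain ⟨xs, hxs, hle⟩ := exists_seq_forall_of_frequently hfr
  have hy0 : 0 ≤ y := (integral_nonneg (h0 (xs 0))).trans (hle 0)
  have hF : ∀ x, ENNReal.ofReal (∫ t, f x t ∂ρ) = ∫⁻ t, ENNReal.ofReal (f x t) ∂ρ := fun x =>
    ofReal_integral_eq_lintegral_ofReal (hi x) (ae_of_all _ (h0 x))
  have h1 : ENNReal.ofReal (∫ t, f x t ∂ρ) ≤ ENNReal.ofReal y := by
    calc ENNReal.ofReal (∫ t, f x t ∂ρ) = ∫⁻ t, ENNReal.ofReal (f x t) ∂ρ := hF x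
      _ = ∫⁻ t, liminf (fun n => ENNReal.ofReal (f (xs n) t)) atTop ∂ρ := by
        refine lintegral_congr fun t => ?_
        exact (((ENNReal.continuous_ofReal.tendsto _).comp
          (((hc t).tendsto x).comp hxs)).liminf_eq).symm
      _ ≤ liminf (fun n => ∫⁻ t, ENNReal.ofReal (f (xs n) t) ∂ρ) atTop :=
        lintegral_liminf_le fun n => (hm _).ennreal_ofReal
      _ ≤ liminf (fun _ : ℕ => ENNReal.ofReal y) atTop := by
        refine liminf_le_liminf (Eventually.of_forall fun n => ?_)
        rw [← hF]
        exact ENNReal.ofReal_le_ofReal (hle n)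
      _ = ENNReal.ofReal y := liminf_const _
  exact absurd ((ENNReal.ofReal_le_ofReal_iff hy0).1 h1) (not_le.2 hy)

/-- Scheffé's idea: two lower semicontinuous functions with constant sum are also upper
semicontinuous. No dominating function is required. -/
lemma continuous_integral_of_add_eq_const {f f' : X → T → ℝ} (h0 : ∀ x t, 0 ≤ f x t)
    (hm : ∀ x, Measurable (f x)) (hi : ∀ x, Integrable (f x) ρ)
    (hc : ∀ t, Continuous fun x => f x t) (h0' : ∀ x t, 0 ≤ f' x t)
    (hm' : ∀ x, Measurable (f' x)) (hi' : ∀ x, Integrable (f' x) ρ)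
    (hc' : ∀ t, Continuous fun x => f' x t) {c : ℝ}
    (hsum : ∀ x, ∫ t, f x t ∂ρ + ∫ t, f' x t ∂ρ = c) : Continuous fun x => ∫ t, f x t ∂ρ := by
  refine continuous_iff_lower_upperSemicontinuous.2
    ⟨lowerSemicontinuous_integral h0 hm hi hc, fun x y hy => ?_⟩
  have := lowerSemicontinuous_integral h0' hm' hi' hc' x (c - y)
    (by have := hsum x; simp only; linarith)
  filter_upwards [this] with x' hx'
  have := hsum x'
  linarith

end Semicontinuity

section Argmax

variable {X : Type*} [MetricSpace X] [CompactSpace X] [Nonempty X]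

lemma argmaxSet_nonempty_of_continuous {f : X → ℝ} (hf : Continuous f) :
    (argmaxSet f).Nonempty := by
  obtain ⟨x, -, hx⟩ := isCompact_univ.exists_isMaxOn Set.univ_nonempty hf.continuousOn
  exact ⟨x, fun y => hx (Set.mem_univ y)⟩

end Argmax

/-! ### Continuity of the expected utility, its role as marginal density, and modes -/

namespace IsMeasurableModel

variable {X Y Θ : Type*} [MetricSpace X] [CompactSpace X] [Nonempty X] [MeasurableSpace X]
  [BorelSpace X] [MeasurableSpace Y] [TopologicalSpace Θ] [MeasurableSpace Θ]
  {lX : Measure X} [IsFiniteMeasure lX] {ν : Measure Y} [IsProbabilityMeasure ν]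
  {lT : Measure Θ} [SigmaFinite lT] {u : X → Θ → ℝ} {p : X → Y → Θ → ℝ} {g : X → X → ℝ}
  (h : IsMeasurableModel lX lT u p g)
include h

lemma measurable_utility_right (x : X) : Measurable fun t : Y × Θ => u x t.2 :=
  h.measurable_utility.comp (f := fun t : Y × Θ => (x, t.2)) (by fun_prop)

lemma measurable_density_right' (x : X) : Measurable fun t : Y × Θ => p x t.1 t.2 :=
  h.measurable_density.comp (measurable_prodMk_left (x := x))

lemma integrable_density (x : X) : Integrable (fun t : Y × Θ => p x t.1 t.2) (ν.prod lT) := by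
  refine ⟨(h.measurable_density_right' x).aestronglyMeasurable, ?_⟩
  rw [hasFiniteIntegral_iff_ofReal (ae_of_all _ fun t => (h.regular.density_pos _ _ _).le),
    h.lintegral_density]
  exact ENNReal.one_lt_top

lemma integral_density (x : X) : ∫ t : Y × Θ, p x t.1 t.2 ∂ν.prod lT = 1 := by
  rw [integral_eq_lintegral_of_nonneg_ae (ae_of_all _ fun t => (h.regular.density_pos _ _ _).le)
    (h.measurable_density_right' x).aestronglyMeasurable, h.lintegral_density]
  simp

lemma exists_tail_le (ν : Measure Y) [IsProbabilityMeasure ν] {ε : ℝ} (hε : 0 < ε) :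
    ∃ B : ℝ, 0 ≤ B ∧ ∀ x, ∫⁻ t, {t : Y × Θ | B < u x t.2}.indicator
      (fun t => ENNReal.ofReal (u x t.2 * p x t.1 t.2)) t ∂ν.prod lT ≤ ENNReal.ofReal ε := by
  obtain ⟨B, hB⟩ := h.regular.utility_integrable ε hε
  -- Raising the level to at least `0` only shrinks the tail, and makes it usable as a nonnegative
  -- truncation level.
  refine ⟨max B 0, le_max_right _ _, fun x => ?_⟩
  have mu : Measurable fun θ => u x θ := h.measurable_utility.comp measurable_prodMk_left
  have hm : MeasurableSet {t : Y × Θ | max B 0 < u x t.2} :=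
    measurableSet_lt measurable_const (h.measurable_utility_right x)
  have mw : Measurable fun t : Y × Θ => ENNReal.ofReal (u x t.2 * p x t.1 t.2) :=
    ((h.measurable_utility_right x).mul (h.measurable_density_right' x)).ennreal_ofReal
  rw [lintegral_prod _ (mw.indicator hm).aemeasurable]
  calc ∫⁻ y, ∫⁻ θ, {t : Y × Θ | max B 0 < u x t.2}.indicator
        (fun t => ENNReal.ofReal (u x t.2 * p x t.1 t.2)) (y, θ) ∂lT ∂ν
      ≤ ∫⁻ y, ENNReal.ofReal ε ∂ν := by
        refine lintegral_mono fun y => le_trans ?_ (hB x y)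
        rw [← lintegral_indicator (measurableSet_lt measurable_const mu)]
        refine lintegral_mono fun θ => ?_
        simp only [Set.indicator, Set.mem_ofPred_eq]
        split_ifs with h1 h2
        · exact le_rfl
        · exact absurd ((le_max_left _ _).trans_lt h1) h2
        · exact zero_le
        · exact le_rfl
    _ = ENNReal.ofReal ε := by simp

/-- Below the level `B` the weight is at most `B` times a probability density; above it the uniform
tail bound applies. -/
lemma integrable_weight (x : X) :
    Integrable (fun t : Y × Θ => u x t.2 * p x t.1 t.2) (ν.prod lT) := by
  obtain ⟨B, hB0, hB⟩ := h.exists_tail_le ν one_pos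
  refine ⟨((h.measurable_utility_right x).mul
    (h.measurable_density_right' x)).aestronglyMeasurable, ?_⟩
  rw [hasFiniteIntegral_iff_ofReal (ae_of_all _ fun t =>
    (mul_pos (h.regular.utility_pos _ _) (h.regular.density_pos _ _ _)).le)]
  calc ∫⁻ t : Y × Θ, ENNReal.ofReal (u x t.2 * p x t.1 t.2) ∂ν.prod lT
      ≤ ∫⁻ t : Y × Θ, (ENNReal.ofReal B * ENNReal.ofReal (p x t.1 t.2) +
        {t : Y × Θ | B < u x t.2}.indicator
          (fun t => ENNReal.ofReal (u x t.2 * p x t.1 t.2)) t) ∂ν.prod lT := by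
        refine lintegral_mono fun t => ?_
        by_cases ht : B < u x t.2
        · simp [Set.indicator, ht]
        · simp only [Set.indicator, Set.mem_ofPred_eq, ht, if_false, add_zero,
            ← ENNReal.ofReal_mul hB0]
          exact ENNReal.ofReal_le_ofReal (mul_le_mul_of_nonneg_right (not_lt.1 ht)
            (h.regular.density_pos _ _ _).le)
    _ ≤ ENNReal.ofReal B * 1 + ENNReal.ofReal 1 := by
        rw [lintegral_add_left ((h.measurable_density_right x).const_mul _),
          lintegral_const_mul _ (h.measurable_density_right x), h.lintegral_density]
        gcongr
        exact hB x
    _ < ⊤ := by finiteness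

lemma expectedUtility_eq (x : X) :
    expectedUtility lT ν u p x = ∫ t : Y × Θ, u x t.2 * p x t.1 t.2 ∂ν.prod lT :=
  (integral_prod _ (h.integrable_weight x)).symm

lemma ofReal_expectedUtility (x : X) : ENNReal.ofReal (expectedUtility lT ν u p x) =
    ∫⁻ t : Y × Θ, ENNReal.ofReal (u x t.2 * p x t.1 t.2) ∂ν.prod lT := by
  rw [h.expectedUtility_eq]
  exact ofReal_integral_eq_lintegral_ofReal (h.integrable_weight x) (ae_of_all _ fun t =>
    (mul_pos (h.regular.utility_pos _ _) (h.regular.density_pos _ _ _)).le)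

lemma expectedUtility_pos (x : X) : 0 < expectedUtility lT ν u p x := by
  rw [h.expectedUtility_eq]
  have hpos : ∀ t : Y × Θ, 0 < u x t.2 * p x t.1 t.2 := fun t =>
    mul_pos (h.regular.utility_pos _ _) (h.regular.density_pos _ _ _)
  rw [integral_pos_iff_support_of_nonneg (fun t => (hpos t).le) (h.integrable_weight x)]
  have : Function.support (fun t : Y × Θ => u x t.2 * p x t.1 t.2) = Set.univ :=
    Set.eq_univ_of_forall fun t => (hpos t).ne'
  rw [this, pos_iff_ne_zero]
  intro h0
  -- The reference measure `ν ⊗ lT` is nonzero because it carries a probability density.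
  have h1 := h.lintegral_density (ν := ν) x
  rw [Measure.measure_univ_eq_zero.1 h0] at h1
  simp at h1

/-- The truncated weight and its complement `(B - min u B) * p` are nonnegative and add up to `B *
p`, whose integral is `B` for every decision. -/
lemma continuous_truncated {B : ℝ} (hB : 0 ≤ B) :
    Continuous fun x => ∫ t : Y × Θ, min (u x t.2) B * p x t.1 t.2 ∂ν.prod lT := by
  have hu := fun x θ => (h.regular.utility_pos x θ).le
  have hp := fun x y θ => (h.regular.density_pos x y θ).le
  have mu := h.measurable_utility_right (Y := Y)
  have mp := h.measurable_density_right'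
  have cu : ∀ θ, Continuous fun x => u x θ := fun θ =>
    h.regular.utility_continuous.comp (Continuous.prodMk_left θ)
  have cp := h.regular.density_continuous
  have i1 : ∀ x, Integrable (fun t : Y × Θ => min (u x t.2) B * p x t.1 t.2) (ν.prod lT) :=
    fun x => ((h.integrable_density x).const_mul B).mono'
      (((mu x).min measurable_const).mul (mp x)).aestronglyMeasurable (ae_of_all _ fun t => by
        rw [Real.norm_eq_abs, abs_of_nonneg (mul_nonneg (le_min (hu _ _) hB) (hp _ _ _))]
        exact mul_le_mul_of_nonneg_right (min_le_right _ _) (hp _ _ _))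
  have e : ∀ x (t : Y × Θ), (B - min (u x t.2) B) * p x t.1 t.2 =
      B * p x t.1 t.2 - min (u x t.2) B * p x t.1 t.2 := fun x t => by ring
  have i2 : ∀ x, Integrable (fun t : Y × Θ => (B - min (u x t.2) B) * p x t.1 t.2)
      (ν.prod lT) := fun x => by
    simp_rw [e]
    exact ((h.integrable_density x).const_mul B).sub (i1 x)
  refine continuous_integral_of_add_eq_const (c := B)
    (f' := fun x (t : Y × Θ) => (B - min (u x t.2) B) * p x t.1 t.2)
    (fun x t => mul_nonneg (le_min (hu _ _) hB) (hp _ _ _))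
    (fun x => ((mu x).min measurable_const).mul (mp x)) i1
    (fun t => ((cu _).min continuous_const).mul (cp _ _))
    (fun x t => mul_nonneg (sub_nonneg.2 (min_le_right _ _)) (hp _ _ _))
    (fun x => (measurable_const.sub ((mu x).min measurable_const)).mul (mp x)) i2
    (fun t => (continuous_const.sub ((cu _).min continuous_const)).mul (cp _ _)) fun x => ?_
  rw [← integral_add (i1 x) (i2 x)]
  have : ∀ t : Y × Θ, min (u x t.2) B * p x t.1 t.2 + (B - min (u x t.2) B) * p x t.1 t.2 =
      B * p x t.1 t.2 := fun t => by ring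
  simp_rw [this]
  rw [integral_const_mul, h.integral_density, mul_one]

/-- Truncation changes the integral by at most the tail, which is small uniformly in the decision; a
uniform limit of continuous functions is continuous. -/
lemma continuous_expectedUtility : Continuous (expectedUtility lT ν u p) := by
  refine continuous_of_uniform_approx_of_continuous fun s hs => ?_
  obtain ⟨ε, hε, hs⟩ := Metric.mem_uniformity_dist.1 hs
  obtain ⟨B, hB0, hB⟩ := h.exists_tail_le ν (half_pos hε)
  refine ⟨_, h.continuous_truncated (ν := ν) hB0, fun x => hs ?_⟩
  have hp := fun y θ => (h.regular.density_pos x y θ).le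
  have hu := fun θ => (h.regular.utility_pos x θ).le
  have i1 : Integrable (fun t : Y × Θ => min (u x t.2) B * p x t.1 t.2) (ν.prod lT) :=
    ((h.integrable_weight x)).mono' (((h.measurable_utility_right x).min measurable_const).mul
      (h.measurable_density_right' x)).aestronglyMeasurable (ae_of_all _ fun t => by
        rw [Real.norm_eq_abs, abs_of_nonneg (mul_nonneg (le_min (hu _) hB0) (hp _ _))]
        exact mul_le_mul_of_nonneg_right (min_le_left _ _) (hp _ _))
  rw [h.expectedUtility_eq, Real.dist_eq, ← integral_sub (h.integrable_weight x) i1]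
  have hnn : ∀ t : Y × Θ, 0 ≤ u x t.2 * p x t.1 t.2 - min (u x t.2) B * p x t.1 t.2 := fun t =>
    sub_nonneg.2 (mul_le_mul_of_nonneg_right (min_le_left _ _) (hp _ _))
  rw [abs_of_nonneg (integral_nonneg hnn)]
  have hle : ENNReal.ofReal (∫ t : Y × Θ, (u x t.2 * p x t.1 t.2 -
      min (u x t.2) B * p x t.1 t.2) ∂ν.prod lT) ≤ ENNReal.ofReal (ε / 2) := by
    rw [ofReal_integral_eq_lintegral_ofReal (f := fun t : Y × Θ =>
      u x t.2 * p x t.1 t.2 - min (u x t.2) B * p x t.1 t.2)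
      ((h.integrable_weight x).sub i1) (ae_of_all _ hnn)]
    refine le_trans (lintegral_mono fun t => ?_) (hB x)
    by_cases ht : B < u x t.2
    · simp only [Set.indicator, Set.mem_ofPred_eq, ht, if_true]
      exact ENNReal.ofReal_le_ofReal (sub_le_self _ (mul_nonneg (le_min (hu _) hB0) (hp _ _)))
    · simp [Set.indicator, ht, min_eq_left (not_lt.1 ht)]
  exact ((ENNReal.ofReal_le_ofReal_iff (half_pos hε).le).1 hle).trans_lt (half_lt_self hε)

lemma integrable_expectedUtility : Integrable (expectedUtility lT ν u p) lX :=
  h.continuous_expectedUtility.integrable_of_hasCompactSupport (HasCompactSupport.of_compactSpace _)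

lemma integral_expectedUtility_pos [lX.IsOpenPosMeasure] :
    0 < ∫ x, expectedUtility lT ν u p x ∂lX := by
  rw [integral_pos_iff_support_of_nonneg (fun x => (h.expectedUtility_pos x).le)
    h.integrable_expectedUtility]
  have : Function.support (expectedUtility lT ν u p) = Set.univ :=
    Set.eq_univ_of_forall fun x => (h.expectedUtility_pos x).ne'
  rw [this]
  exact isOpen_univ.measure_pos lX Set.univ_nonempty

lemma map_fst_unnormalized : (unnormalizedAugmented lX ν lT u p).map Prod.fst =
    lX.withDensity fun x => ENNReal.ofReal (expectedUtility lT ν u p x) := by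
  ext A hA
  rw [Measure.map_apply measurable_fst hA, unnormalizedAugmented,
    withDensity_apply _ (measurable_fst hA), withDensity_apply _ hA,
    ← lintegral_indicator (measurable_fst hA), ← lintegral_indicator hA,
    lintegral_prod _ (h.measurable_weight.indicator (measurable_fst hA)).aemeasurable]
  refine lintegral_congr fun x => ?_
  by_cases hx : x ∈ A
  · simp [Set.indicator, hx, h.ofReal_expectedUtility]
  · simp [Set.indicator, hx]

lemma unnormalizedAugmented_univ : unnormalizedAugmented lX ν lT u p Set.univ =
    ENNReal.ofReal (∫ x, expectedUtility lT ν u p x ∂lX) := by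
  rw [← Set.preimage_univ (f := Prod.fst), ← Measure.map_apply measurable_fst .univ,
    h.map_fst_unnormalized, withDensity_apply _ .univ, Measure.restrict_univ,
    ofReal_integral_eq_lintegral_ofReal h.integrable_expectedUtility
      (ae_of_all _ fun x => (h.expectedUtility_pos x).le)]

lemma isProbabilityMeasure_augmented [lX.IsOpenPosMeasure] :
    IsProbabilityMeasure (augmented lX ν lT u p) := by
  constructor
  rw [augmented, Measure.smul_apply, smul_eq_mul]
  refine ENNReal.inv_mul_cancel ?_ ?_ <;> rw [h.unnormalizedAugmented_univ]
  · simpa using h.integral_expectedUtility_pos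
  · exact ENNReal.ofReal_ne_top

lemma map_fst_augmented [lX.IsOpenPosMeasure] :
    (augmented lX ν lT u p).map Prod.fst = lX.withDensity fun x => ENNReal.ofReal
      (expectedUtility lT ν u p x / ∫ x', expectedUtility lT ν u p x' ∂lX) := by
  rw [augmented, Measure.map_smul, h.map_fst_unnormalized, h.unnormalizedAugmented_univ,
    ← withDensity_smul _ h.continuous_expectedUtility.measurable.ennreal_ofReal]
  congr 1
  funext x
  rw [Pi.smul_apply, smul_eq_mul, div_eq_inv_mul, ENNReal.ofReal_mul
    (inv_nonneg.2 h.integral_expectedUtility_pos.le),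
    ENNReal.ofReal_inv_of_pos h.integral_expectedUtility_pos]

lemma argmaxSet_nonempty : (argmaxSet (expectedUtility lT ν u p)).Nonempty :=
  argmaxSet_nonempty_of_continuous h.continuous_expectedUtility

/-- Densities of the same measure agree almost everywhere, and continuous ones agree everywhere
under full support. Dividing by the positive total does not move the maximisers. -/
lemma modeSet_eq [lX.IsOpenPosMeasure] : modeSet lX ((augmented lX ν lT u p).map Prod.fst) =
    argmaxSet (expectedUtility lT ν u p) := by
  set ψ := expectedUtility lT ν u p
  set Z := ∫ x', ψ x' ∂lX
  have hZ : 0 < Z := h.integral_expectedUtility_pos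
  have hψ : Continuous ψ := h.continuous_expectedUtility
  have hψ0 : ∀ x, 0 ≤ ψ x / Z := fun x => div_nonneg (h.expectedUtility_pos x).le hZ.le
  have hc : Continuous fun x => ψ x / Z := hψ.div_const Z
  ext x
  constructor
  · rintro ⟨f, hf, hf0, hfd, hmax⟩ y
    rw [h.map_fst_augmented, withDensity_eq_iff_of_sigmaFinite
      hc.measurable.ennreal_ofReal.aemeasurable hf.measurable.ennreal_ofReal.aemeasurable] at hfd
    have hfd' : (fun x => ψ x / Z) =ᵐ[lX] f := hfd.mono fun t ht =>
      (ENNReal.ofReal_eq_ofReal_iff (hψ0 t) (hf0 t)).1 ht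
    have heq := (Continuous.ae_eq_iff_eq lX hc hf).1 hfd'
    have := hmax y
    rw [← heq] at this
    exact (div_le_div_iff_of_pos_right hZ).1 this
  · intro hx
    exact ⟨fun x => ψ x / Z, hc, hψ0, h.map_fst_augmented, fun y =>
      (div_le_div_iff_of_pos_right hZ).2 (hx y)⟩

lemma mhStep_decomposition (s : X × Y × Θ) :
    ∃ (a : Measure (X × Y × Θ)) (r : ENNReal), mhStep lX ν lT u p g s = a + r • Measure.dirac s ∧
      a ≪ augmented lX ν lT u p ∧ augmented lX ν lT u p ≪ a :=
  h.absolutelyContinuous_augmented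
    (by rw [h.unnormalizedAugmented_univ]; exact ENNReal.ofReal_ne_top) s

theorem samplesAugmented [lX.IsOpenPosMeasure] {κ : Kernel (X × Y × Θ) (X × Y × Θ)}
    [IsMarkovKernel κ] (hκ : ∀ s, κ s = mhStep lX ν lT u p g s) :
    SamplesAugmented lX ν lT u p g κ where
  kernel_eq := hκ
  isProbability := h.isProbabilityMeasure_augmented
  stationary := h.invariant hκ
  unique μ _ hμ := by
    have := h.isProbabilityMeasure_augmented (ν := ν)
    exact eq_of_invariant (h.invariant hκ)
      (fun s => by rw [hκ]; exact h.mhStep_decomposition s) hμ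
  marginal := h.map_fst_augmented
  continuous := h.continuous_expectedUtility
  exists_optimal := h.argmaxSet_nonempty
  modes_eq := h.modeSet_eq

/-- The law of large numbers for the decisions visited by the chain. -/
theorem ae_tendsto_timeAverage [lX.IsOpenPosMeasure] {κ : Kernel (X × Y × Θ) (X × Y × Θ)}
    [IsMarkovKernel κ] (hκ : ∀ s, κ s = mhStep lX ν lT u p g s) {φ : X → ℝ} (hφ : Measurable φ)
    {C : ℝ} (hC : ∀ x, |φ x| ≤ C) (s : X × Y × Θ) :
    ∀ᵐ z ∂pathKernel κ s, Tendsto (fun n => timeAverage (fun s => φ s.1) n z) atTop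
      (𝓝 ((∫ x, φ x * expectedUtility lT ν u p x ∂lX) /
        ∫ x, expectedUtility lT ν u p x ∂lX)) := by
  have := h.isProbabilityMeasure_augmented (ν := ν)
  have hlim : ∫ s, φ s.1 ∂augmented lX ν lT u p =
      (∫ x, φ x * expectedUtility lT ν u p x ∂lX) / ∫ x, expectedUtility lT ν u p x ∂lX := by
    rw [← integral_map (φ := Prod.fst) measurable_fst.aemeasurable
      (f := φ) hφ.aestronglyMeasurable, h.map_fst_augmented, integral_withDensity_eq_integral_toReal_smul
      (h.continuous_expectedUtility.div_const _).measurable.ennreal_ofReal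
      (ae_of_all _ fun _ => ENNReal.ofReal_lt_top), ← integral_div]
    refine integral_congr_ae (ae_of_all _ fun x => ?_)
    simp only
    rw [ENNReal.toReal_ofReal (div_nonneg (h.expectedUtility_pos x).le
      h.integral_expectedUtility_pos.le), smul_eq_mul]
    ring
  rw [← hlim]
  exact APS.ae_tendsto_timeAverage (h.invariant hκ)
    (fun s => by rw [hκ]; exact h.mhStep_decomposition s) (hφ.comp measurable_fst)
    (fun s => hC _) s

end IsMeasurableModel

/-! ### Parzen's mode estimator -/

section Diagonal

variable {Z : Type*} [MeasurableSpace Z] {Q : Measure Z} [IsFiniteMeasure Q]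

/-- If `E k n` tends to `0` almost surely as `n → ∞` for every `k`, then so does `E (κ n) n` for
some `κ n` tending to infinity slowly. -/
lemma exists_diagonal {E : ℕ → ℕ → Z → ℝ} (hm : ∀ k n, Measurable (E k n))
    (hE : ∀ k, ∀ᵐ z ∂Q, Tendsto (fun n => E k n z) atTop (𝓝 0)) :
    ∃ κ : ℕ → ℕ, Tendsto κ atTop atTop ∧ ∀ᵐ z ∂Q, Tendsto (fun n => E (κ n) n z) atTop (𝓝 0) := by
  have h1 : ∀ k : ℕ, ∃ (t : Set Z) (N : ℕ), Q t ≤ ENNReal.ofReal ((1 / 2 : ℝ) ^ k) ∧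
      ∀ n ≥ N, ∀ z ∉ t, |E k n z| < ((k : ℝ) + 1)⁻¹ := fun k => by
    -- Egorov's theorem with exceptional sets of mass at most `2⁻ᵏ`, chosen summable for
    -- Borel–Cantelli.
    obtain ⟨t, -, ht, hu⟩ := tendstoUniformlyOn_of_ae_tendsto' (μ := Q) (f := E k) (g := fun _ => 0)
      (fun n => (hm k n).stronglyMeasurable) stronglyMeasurable_const (hE k)
      (ε := (1 / 2 : ℝ) ^ k) (by positivity)
    obtain ⟨N, hN⟩ := eventually_atTop.1 (Metric.tendstoUniformlyOn_iff.1 hu _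
      (by positivity : (0 : ℝ) < ((k : ℝ) + 1)⁻¹))
    exact ⟨t, N, ht, fun n hn z hz => by simpa [Real.dist_eq] using hN n hn z hz⟩
  choose t N ht hN using h1
  classical
  -- The largest index `k ≤ n` whose uniform bound is already in force at `n`. The search returns
  -- `0` when there is none, so `N (κ n) ≤ n` is only claimed for `n ≥ N 0`.
  let κ : ℕ → ℕ := fun n => Nat.findGreatest (fun k => N k ≤ n) n
  have hκ : Tendsto κ atTop atTop := by
    refine tendsto_atTop.2 fun k => ?_
    filter_upwards [eventually_ge_atTop k, eventually_ge_atTop (N k)] with n h1 h2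
    exact Nat.le_findGreatest h1 h2
  have hκN : ∀ᶠ n in atTop, N (κ n) ≤ n := by
    filter_upwards [eventually_ge_atTop (N 0)] with n hn
    exact Nat.findGreatest_spec (P := fun k => N k ≤ n) (Nat.zero_le n) hn
  refine ⟨κ, hκ, ?_⟩
  have hsum : ∑' k, Q (t k) ≠ ⊤ := by
    refine ne_top_of_le_ne_top ?_ (ENNReal.tsum_le_tsum ht)
    rw [← ENNReal.ofReal_tsum_of_nonneg (fun k => by positivity)
      (summable_geometric_of_lt_one (by norm_num) (by norm_num))]
    exact ENNReal.ofReal_ne_top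
  filter_upwards [ae_eventually_notMem hsum] with z hz
  have hlim : Tendsto (fun n => ((κ n : ℝ) + 1)⁻¹) atTop (𝓝 0) :=
    (tendsto_inv_atTop_zero.comp (tendsto_atTop_add_const_right _ 1
      tendsto_natCast_atTop_atTop)).comp hκ
  refine squeeze_zero_norm' ?_ hlim
  filter_upwards [hκN, hκ.eventually hz] with n h1 h2
  exact (hN _ n h1 z h2).le

end Diagonal

/-! ### Stability of maximisers under uniform approximation -/

section Argmax

variable {X : Type*} [MetricSpace X] [CompactSpace X] [Nonempty X]

/-- Maximisers of uniform approximations of `f` approach the maximisers of `f`. -/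
lemma tendsto_infDist_argmaxSet {f : X → ℝ} (hf : Continuous f) {F : ℕ → X → ℝ}
    (hF : TendstoUniformly F f atTop) {m : ℕ → X} (hm : ∀ n, m n ∈ argmaxSet (F n)) :
    Tendsto (fun n => Metric.infDist (m n) (argmaxSet f)) atTop (𝓝 0) := by
  obtain ⟨x₀, hx₀⟩ := argmaxSet_nonempty_of_continuous hf
  rw [Metric.tendsto_nhds]
  intro ε hε
  have hcl : IsClosed {x | ε ≤ Metric.infDist x (argmaxSet f)} :=
    isClosed_le continuous_const (Metric.continuous_infDist_pt _)
  obtain hemp | hne := {x | ε ≤ Metric.infDist x (argmaxSet f)}.eq_empty_or_nonempty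
  · refine Eventually.of_forall fun n => ?_
    rw [Real.dist_eq, sub_zero, abs_of_nonneg Metric.infDist_nonneg]
    by_contra hcon
    have : m n ∈ {x | ε ≤ Metric.infDist x (argmaxSet f)} := not_lt.1 hcon
    rw [hemp] at this
    exact this
  -- By compactness, `f` stays below its maximum by a fixed gap at distance at least `ε` from the
  -- maximisers. An error below half the gap keeps approximate maximisers out of that region.
  · obtain ⟨x₁, hx₁, hmax⟩ := hcl.isCompact.exists_isMaxOn hne hf.continuousOn
    have hlt : f x₁ < f x₀ := by
      refine lt_of_le_of_ne (hx₀ x₁) fun heq => ?_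
      have : x₁ ∈ argmaxSet f := fun y => heq ▸ hx₀ y
      have h0 := Metric.infDist_zero_of_mem this
      have h1 : ε ≤ Metric.infDist x₁ (argmaxSet f) := hx₁
      linarith
    filter_upwards [Metric.tendstoUniformly_iff.1 hF ((f x₀ - f x₁) / 2) (by linarith)] with n hn
    rw [Real.dist_eq, sub_zero, abs_of_nonneg Metric.infDist_nonneg]
    by_contra hcon
    have h1 : f (m n) ≤ f x₁ := hmax (not_lt.1 hcon : ε ≤ Metric.infDist (m n) (argmaxSet f))
    have h2 := hm n x₀
    have h3 := hn x₀
    have h4 := hn (m n)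
    rw [Real.dist_eq, abs_lt] at h3 h4
    linarith [h3.1, h3.2, h4.1, h4.2]

end Argmax

/-! ### Bias and uniform error of the kernel density estimate -/

section Parzen

variable {X : Type*} [MetricSpace X] [CompactSpace X] [Nonempty X] [MeasurableSpace X]
  [BorelSpace X] (lX : Measure X) [IsFiniteMeasure lX] [lX.IsOpenPosMeasure]

/-- The normalised bump of Parzen's estimate. -/
def bump (K : ℝ → ℝ) (h : ℝ) (x y : X) : ℝ := K (dist x y / h) / ∫ y, K (dist x y / h) ∂lX

lemma kernelDensity_eq (K : ℝ → ℝ) (h : ℝ) (z : ℕ → X) (n : ℕ) (x : X) :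
    kernelDensity lX K h (fun i : Fin n => z i) x = timeAverage (bump lX K h x) n z := by
  simp only [kernelDensity, timeAverage, bump]
  rw [Fin.sum_univ_eq_sum_range (fun i => K (dist x (z i) / h)) n, ← Finset.sum_div, mul_div_assoc]

variable {lX} {K : ℝ → ℝ} (hK : IsSmoothingKernel K) {h : ℝ} (hh : 0 < h)
include hK hh

lemma integrable_profile (x : X) : Integrable (fun y => K (dist x y / h)) lX :=
  (hK.continuous.comp (by fun_prop : Continuous fun y => dist x y / h)).integrable_of_hasCompactSupport
    (HasCompactSupport.of_compactSpace _)

lemma integral_profile_pos (x : X) : 0 < ∫ y, K (dist x y / h) ∂lX := by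
  have hc : Continuous fun y => K (dist x y / h) := hK.continuous.comp (by fun_prop)
  rw [integral_pos_iff_support_of_nonneg (fun y => hK.nonneg _) (integrable_profile hK hh x)]
  exact hc.isOpen_support.measure_pos lX ⟨x, by simpa using hK.pos.ne'⟩

lemma continuous_bump : Continuous fun z : X × X => bump lX K h z.1 z.2 := by
  have h1 : Continuous fun z : X × X => K (dist z.1 z.2 / h) := hK.continuous.comp (by fun_prop)
  have h2 : Continuous fun x : X => ∫ y, K (dist x y / h) ∂lX := by
    have := continuous_parametric_integral_of_continuous (μ := lX)
      (f := fun x y : X => K (dist x y / h)) h1 isCompact_univ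
    simpa using this
  exact h1.div (h2.comp continuous_fst) fun z => (integral_profile_pos hK hh _).ne'

lemma bump_nonneg (x y : X) : 0 ≤ bump lX K h x y :=
  div_nonneg (hK.nonneg _) (integral_profile_pos hK hh x).le

lemma integral_bump (x : X) : ∫ y, bump lX K h x y ∂lX = 1 := by
  simp only [bump]
  rw [integral_div, div_self (integral_profile_pos hK hh x).ne']

lemma continuous_bump_right (x : X) : Continuous (bump lX K h x) :=
  (continuous_bump hK hh).comp (Continuous.prodMk_right x)

lemma bump_eq_zero {x y : X} (hxy : h ≤ dist x y) : bump lX K h x y = 0 := by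
  rw [bump, hK.support _ ((one_le_div hh).2 hxy), zero_div]

lemma exists_dist_bump_lt {ε : ℝ} (hε : 0 < ε) :
    ∃ δ > 0, ∀ x x' y : X, dist x x' < δ → |bump lX K h x y - bump lX K h x' y| < ε := by
  have huc := CompactSpace.uniformContinuous_of_continuous (continuous_bump (lX := lX) hK hh)
  obtain ⟨δ, hδ, hd⟩ := Metric.uniformContinuous_iff.1 huc ε hε
  exact ⟨δ, hδ, fun x x' y hx => by
    simpa [Real.dist_eq] using @hd (x, y) (x', y) (by simpa [Prod.dist_eq, hδ] using hx)⟩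

/-- The bump at `x` is a probability density vanishing at distance `h` or more, so smoothing
averages values of `f` near `x`. -/
lemma smoothing_dist_le {f : X → ℝ} (hf : Continuous f) {ε : ℝ}
    (hε : ∀ x y, dist x y < h → |f y - f x| ≤ ε) (x : X) :
    |∫ y, bump lX K h x y * f y ∂lX - f x| ≤ ε := by
  have hb := continuous_bump_right (lX := lX) hK hh x
  have i1 : ∀ {φ : X → ℝ}, Continuous φ → Integrable φ lX := fun hφ =>
    hφ.integrable_of_hasCompactSupport (HasCompactSupport.of_compactSpace _)
  have ib : ∀ c : ℝ, Integrable (fun y => bump lX K h x y * c) lX := fun c =>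
    i1 (hb.mul continuous_const)
  have ibf : Integrable (fun y => bump lX K h x y * f y) lX := i1 (hb.mul hf)
  have e : ∫ y, bump lX K h x y * f y ∂lX - f x = ∫ y, bump lX K h x y * (f y - f x) ∂lX := by
    simp_rw [mul_sub]
    rw [integral_sub ibf (ib _), integral_mul_const,
      integral_bump hK hh, one_mul]
  rw [e]
  calc |∫ y, bump lX K h x y * (f y - f x) ∂lX|
      ≤ ∫ y, bump lX K h x y * ε ∂lX := by
        rw [← Real.norm_eq_abs]
        refine norm_integral_le_of_norm_le (ib ε) (ae_of_all _ fun y => ?_)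
        rw [norm_mul, Real.norm_of_nonneg (bump_nonneg hK hh x y)]
        obtain hxy | hxy := lt_or_ge (dist x y) h
        · exact mul_le_mul_of_nonneg_left (hε x y hxy) (bump_nonneg hK hh x y)
        · simp [bump_eq_zero hK hh hxy]
    _ = ε := by rw [integral_mul_const, integral_bump hK hh, one_mul]

/-- Control of the error of the density estimate at the points of a finite net. -/
lemma exists_net {ε : ℝ} (hε : 0 < ε) : ∃ s : Finset X, ∀ (z : ℕ → X) (n : ℕ) (f : X → ℝ),
    Continuous f → (∀ y, 0 ≤ f y) → ∫ y, f y ∂lX = 1 → ∀ x,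
    |timeAverage (bump lX K h x) n z - ∫ y, bump lX K h x y * f y ∂lX| ≤
      ∑ x' ∈ s, |timeAverage (bump lX K h x') n z - ∫ y, bump lX K h x' y * f y ∂lX| + 2 * ε := by
  obtain ⟨δ, hδ, hd⟩ := exists_dist_bump_lt (lX := lX) hK hh hε
  obtain ⟨s, hs, hcov⟩ := Metric.totallyBounded_iff.1 (isCompact_univ (X := X)).totallyBounded δ hδ
  refine ⟨hs.toFinset, fun z n f hf hf0 hf1 x => ?_⟩
  have i1 : ∀ {φ : X → ℝ}, Continuous φ → Integrable φ lX := fun hφ =>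
    hφ.integrable_of_hasCompactSupport (HasCompactSupport.of_compactSpace _)
  obtain ⟨x', hx's, hx'⟩ := Set.mem_iUnion₂.1 (hcov (Set.mem_univ x))
  have hlt : ∀ y, |bump lX K h x y - bump lX K h x' y| ≤ ε := fun y => (hd x x' y hx').le
  -- Moving `x` to the nearest net point costs `ε` in the empirical average and another `ε` in the
  -- integral, whence the `2 * ε`.
  have h1 : |timeAverage (bump lX K h x) n z - timeAverage (bump lX K h x') n z| ≤ ε := by
    rw [timeAverage, timeAverage, ← mul_sub, ← Finset.sum_sub_distrib, abs_mul,
      abs_of_nonneg (by positivity : (0 : ℝ) ≤ (n : ℝ)⁻¹)]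
    calc (n : ℝ)⁻¹ * |∑ i ∈ Finset.range n, (bump lX K h x (z i) - bump lX K h x' (z i))|
        ≤ (n : ℝ)⁻¹ * ∑ i ∈ Finset.range n, ε := by
          gcongr
          exact (Finset.abs_sum_le_sum_abs _ _).trans (Finset.sum_le_sum fun i _ => hlt _)
      _ ≤ ε := by
          rw [Finset.sum_const, Finset.card_range, nsmul_eq_mul, ← mul_assoc]
          exact mul_le_of_le_one_left hε.le inv_mul_le_one
  have h2 : |∫ y, bump lX K h x y * f y ∂lX - ∫ y, bump lX K h x' y * f y ∂lX| ≤ ε := by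
    have ibf : ∀ x, Integrable (fun y => bump lX K h x y * f y) lX := fun x =>
      i1 ((continuous_bump_right (lX := lX) hK hh x).mul hf)
    rw [← integral_sub (ibf x) (ibf x')]
    calc |∫ y, (bump lX K h x y * f y - bump lX K h x' y * f y) ∂lX|
        ≤ ∫ y, ε * f y ∂lX := by
          rw [← Real.norm_eq_abs]
          refine norm_integral_le_of_norm_le ((i1 hf).const_mul ε) (ae_of_all _ fun y => ?_)
          rw [← sub_mul, norm_mul, Real.norm_of_nonneg (hf0 y)]
          exact mul_le_mul_of_nonneg_right (hlt y) (hf0 y)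
      _ = ε := by rw [integral_const_mul, hf1, mul_one]
  have h3 := Finset.single_le_sum (f := fun x' => |timeAverage (bump lX K h x') n z -
    ∫ y, bump lX K h x' y * f y ∂lX|) (fun _ _ => abs_nonneg _) (hs.mem_toFinset.2 hx's)
  have h4 := abs_le.1 h1
  have h5 := abs_le.1 h2
  have h6 := abs_le.1 h3
  exact abs_le.2 ⟨by linarith, by linarith⟩

omit hh in
/-- If the data obey the law of large numbers for continuous functions with a (possibly random)
continuous density, then for suitable bandwidths the maximisers of Parzen's estimate approach the
maximisers of the density. -/
theorem exists_bandwidths {Z : Type*} [MeasurableSpace Z] {Q : Measure Z} [IsFiniteMeasure Q]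
    {obs : Z → ℕ → X} (hobs : ∀ i, Measurable fun z => obs z i) {f : Z → X → ℝ}
    (hf : ∀ᵐ z ∂Q, Continuous (f z) ∧ (∀ y, 0 ≤ f z y) ∧ ∫ y, f z y ∂lX = 1)
    (hmeas : ∀ φ : X → ℝ, Continuous φ → Measurable fun z => ∫ y, φ y * f z y ∂lX)
    (hlln : ∀ φ : X → ℝ, Continuous φ → ∀ᵐ z ∂Q,
      Tendsto (fun n => timeAverage φ n (obs z)) atTop (𝓝 (∫ y, φ y * f z y ∂lX))) :
    ∃ h : ℕ → ℝ, (∀ n, 0 < h n) ∧ Tendsto h atTop (𝓝 0) ∧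
      ∀ m : (n : ℕ) → (Fin n → X) → X, IsParzenModeEstimator lX K h m →
        ∀ᵐ z ∂Q, Tendsto (fun n => Metric.infDist (m n fun i => obs z i) (argmaxSet (f z)))
          atTop (𝓝 0) := by
  have hbw : ∀ k : ℕ, (0 : ℝ) < ((k : ℝ) + 1)⁻¹ := fun k => by positivity
  have hbw0 : Tendsto (fun k : ℕ => ((k : ℝ) + 1)⁻¹) atTop (𝓝 0) :=
    tendsto_inv_atTop_zero.comp (tendsto_atTop_add_const_right _ 1 tendsto_natCast_atTop_atTop)
  -- Both the bandwidth and the accuracy of the net at stage `k` are `1 / (k + 1)`.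
  choose s hs using fun k => exists_net (lX := lX) hK (hbw k) (hbw k)
  have hcb := fun k => continuous_bump_right (lX := lX) hK (hbw k)
  obtain ⟨κ, hκ, hE⟩ := exists_diagonal (Q := Q)
    (E := fun k n z => ∑ x ∈ s k, |timeAverage (bump lX K ((k : ℝ) + 1)⁻¹ x) n (obs z) -
      ∫ y, bump lX K ((k : ℝ) + 1)⁻¹ x y * f z y ∂lX|)
    (fun k n => by
      refine Finset.measurable_sum _ fun x _ => ?_
      refine (Measurable.sub ?_ (hmeas _ (hcb k x))).abs
      exact (measurable_timeAverage (hcb k x).measurable n).comp (measurable_pi_lambda _ hobs))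
    (fun k => by
      have : ∀ᵐ z ∂Q, ∀ x ∈ s k, Tendsto
          (fun n => timeAverage (bump lX K ((k : ℝ) + 1)⁻¹ x) n (obs z)) atTop
          (𝓝 (∫ y, bump lX K ((k : ℝ) + 1)⁻¹ x y * f z y ∂lX)) :=
        (ae_ball_iff (s k).countable_toSet).2 fun x _ => hlln _ (hcb k x)
      filter_upwards [this] with z hz
      have h0 := tendsto_finsetSum (s k) fun x hx => ((hz x hx).sub_const
        (∫ y, bump lX K ((k : ℝ) + 1)⁻¹ x y * f z y ∂lX)).abs
      simpa using h0)
  refine ⟨fun n => ((κ n : ℝ) + 1)⁻¹, fun n => hbw _, hbw0.comp hκ, fun m hm => ?_⟩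
  filter_upwards [hf, hE] with z ⟨hc, hp, h1⟩ hz
  refine tendsto_infDist_argmaxSet hc
    (F := fun n => kernelDensity lX K ((κ n : ℝ) + 1)⁻¹ fun i : Fin n => obs z i) ?_ (fun n => hm n _)
  rw [Metric.tendstoUniformly_iff]
  intro ε hε
  have hlim : Tendsto (fun n => (∑ x ∈ s (κ n), |timeAverage (bump lX K ((κ n : ℝ) + 1)⁻¹ x) n (obs z) -
      ∫ y, bump lX K ((κ n : ℝ) + 1)⁻¹ x y * f z y ∂lX|) + 2 * ((κ n : ℝ) + 1)⁻¹) atTop (𝓝 0) := by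
    simpa using hz.add ((hbw0.comp hκ).const_mul 2)
  obtain ⟨δ, hδ, hd⟩ := Metric.uniformContinuous_iff.1
    (CompactSpace.uniformContinuous_of_continuous hc) (ε / 2) (half_pos hε)
  filter_upwards [hlim.eventually_lt_const (half_pos hε), (hbw0.comp hκ).eventually_lt_const hδ]
    with n hn1 hn2 x
  have e1 := hs (κ n) (obs z) n (f z) hc hp h1 x
  have e2 := smoothing_dist_le (lX := lX) hK (hbw (κ n)) hc (ε := ε / 2) (fun x y hxy => by
    have := hd (a := y) (b := x) (by rw [dist_comm]; exact hxy.trans hn2)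
    rw [Real.dist_eq] at this
    exact this.le) x
  rw [kernelDensity_eq, Real.dist_eq]
  have e1' := abs_le.1 e1
  have e2' := abs_le.1 e2
  exact abs_lt.2 ⟨by linarith, by linarith⟩

end Parzen

/-! ### The chain in a random environment -/

section Environment

variable {Ω X Y Θ : Type*} [MeasurableSpace Ω] [MetricSpace X] [CompactSpace X] [Nonempty X]
  [MeasurableSpace X] [BorelSpace X] [MeasurableSpace Y] [TopologicalSpace Θ] [MeasurableSpace Θ]
  {lX : Measure X} [IsFiniteMeasure lX] {lT : Measure Θ} [SigmaFinite lT]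
  {η : Kernel Ω Y} [IsMarkovKernel η] {U : Ω → X → Θ → ℝ} {p : Ω → X → Y → Θ → ℝ}
  {g : X → X → ℝ} {G : Set Ω}

/-- Accepting or rejecting candidates is a kernel. -/
lemma exists_acceptReject_kernel {α S : Type*} [MeasurableSpace α] [MeasurableSpace S]
    (base : Kernel α S) [IsSFiniteKernel base] {old : α → S} (mold : Measurable old)
    {q a : α → S → ℝ} (mq : Measurable (Function.uncurry q)) (ma : Measurable (Function.uncurry a)) :
    ∃ step : Kernel α S, ∀ w, step w =
      ((base w).withDensity fun s => ENNReal.ofReal (q w s)).withDensity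
        (fun s => ENNReal.ofReal (a w s)) +
      (∫⁻ s, ENNReal.ofReal (1 - a w s) ∂(base w).withDensity fun s => ENNReal.ofReal (q w s)) •
        Measure.dirac (old w) := by
  let cand : Kernel α S := base.withDensity fun w s => ENNReal.ofReal (q w s)
  have hcand : ∀ w, cand w = (base w).withDensity fun s => ENNReal.ofReal (q w s) :=
    Kernel.withDensity_apply _ mq.ennreal_ofReal
  have : IsSFiniteKernel cand :=
    Kernel.IsSFiniteKernel.withDensity _ fun _ _ => ENNReal.ofReal_ne_top
  have mrej : Measurable fun w => ∫⁻ s, ENNReal.ofReal (1 - a w s) ∂cand w :=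
    Measurable.lintegral_kernel_prod_right (f := fun w s => ENNReal.ofReal (1 - a w s))
      (ma.const_sub 1).ennreal_ofReal
  -- A density that ignores the target state multiplies the Dirac kernel by the rejection
  -- probability, which makes the second summand measurable in `w`.
  refine ⟨cand.withDensity (fun w s => ENNReal.ofReal (a w s)) +
    (Kernel.deterministic old mold).withDensity
      fun w _ => ∫⁻ s, ENNReal.ofReal (1 - a w s) ∂cand w, fun w => ?_⟩
  rw [FunLike.coe_add, Pi.add_apply, Kernel.withDensity_apply _ ma.ennreal_ofReal,
    Kernel.withDensity_apply (f := fun w _ => ∫⁻ s, ENNReal.ofReal (1 - a w s) ∂cand w) _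
      (mrej.comp measurable_fst), withDensity_const,
    Kernel.deterministic_apply, hcand]

variable (lX lT η) in
/-- The Metropolis-Hastings steps in a random environment form a kernel. -/
theorem exists_mhKernel (mU : Measurable fun z : Ω × X × Θ => U z.1 z.2.1 z.2.2)
    (mp : Measurable fun z : Ω × X × Y × Θ => p z.1 z.2.1 z.2.2.1 z.2.2.2)
    (mg : Measurable fun z : X × X => g z.1 z.2) (mG : MeasurableSet G)
    (hG : ∀ ω ∈ G, IsMeasurableModel lX lT (U ω) (p ω) g) :
    ∃ κ : Kernel (Ω × X × Y × Θ) (X × Y × Θ), IsMarkovKernel κ ∧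
      ∀ ω ∈ G, ∀ s, κ (ω, s) = mhStep lX (η ω) lT (U ω) (p ω) g s := by
  classical
  have m1 : Measurable fun w : (Ω × X × Y × Θ) × X × Y × Θ => g w.1.2.1 w.2.1 :=
    mg.comp (f := fun w : (Ω × X × Y × Θ) × X × Y × Θ => (w.1.2.1, w.2.1)) (by fun_prop)
  have m2 : Measurable fun w : (Ω × X × Y × Θ) × X × Y × Θ => p w.1.1 w.2.1 w.2.2.1 w.2.2.2 :=
    mp.comp (f := fun w : (Ω × X × Y × Θ) × X × Y × Θ => (w.1.1, w.2)) (by fun_prop)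
  obtain ⟨step, hstep⟩ := exists_acceptReject_kernel
    ((Kernel.const Ω lX ×ₖ (η ×ₖ Kernel.const Ω lT)).comap Prod.fst
      (measurable_fst (β := X × Y × Θ))) (old := Prod.snd) measurable_snd
    (q := fun w s => g w.2.1 s.1 * p w.1 s.1 s.2.1 s.2.2)
    (a := fun w s => acceptProb (U w.1) g w.2 s) (m1.mul m2) (measurable_acceptProb (Y := Y) mU mg)
  have step_apply : ∀ ω s, step (ω, s) = mhStep lX (η ω) lT (U ω) (p ω) g s := fun ω s => by
    rw [hstep, Kernel.comap_apply, Kernel.prod_apply, Kernel.prod_apply, Kernel.const_apply,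
      Kernel.const_apply]
    rfl
  -- Outside `G` a step need not have total mass one; standing still there makes the kernel Markov
  -- everywhere.
  let stay : Kernel (Ω × X × Y × Θ) (X × Y × Θ) := Kernel.deterministic Prod.snd measurable_snd
  let κ := Kernel.piecewise (measurable_fst mG : MeasurableSet (Prod.fst ⁻¹' G)) step stay
  have hκ : ∀ ω ∈ G, ∀ s, κ (ω, s) = mhStep lX (η ω) lT (U ω) (p ω) g s := fun ω hω s => by
    rw [Kernel.piecewise_apply, if_pos (by exact hω), step_apply]
  refine ⟨κ, ⟨fun w => ?_⟩, hκ⟩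
  by_cases hw : w.1 ∈ G
  · rw [← Prod.mk.eta (p := w), hκ w.1 hw w.2]
    exact (hG _ hw).isProbabilityMeasure_mhStep w.2
  · rw [Kernel.piecewise_apply, if_neg (by exact hw)]
    infer_instance

lemma stronglyMeasurable_expectedUtility
    (mU : Measurable fun z : Ω × X × Θ => U z.1 z.2.1 z.2.2)
    (mp : Measurable fun z : Ω × X × Y × Θ => p z.1 z.2.1 z.2.2.1 z.2.2.2) :
    StronglyMeasurable fun w : Ω × X => expectedUtility lT (η w.1) (U w.1) (p w.1) w.2 := by
  have m1 : Measurable fun w : ((Ω × X) × Y) × Θ => U w.1.1.1 w.1.1.2 w.2 *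
      p w.1.1.1 w.1.1.2 w.1.2 w.2 :=
    (mU.comp (f := fun w : ((Ω × X) × Y) × Θ => (w.1.1.1, w.1.1.2, w.2)) (by fun_prop)).mul
      (mp.comp (f := fun w : ((Ω × X) × Y) × Θ => (w.1.1.1, w.1.1.2, w.1.2, w.2)) (by fun_prop))
  have m2 : StronglyMeasurable fun w : (Ω × X) × Y =>
      ∫ θ, U w.1.1 w.1.2 θ * p w.1.1 w.1.2 w.2 θ ∂lT :=
    m1.stronglyMeasurable.integral_prod_right'
  exact m2.integral_kernel_prod_right' (κ := η.comap Prod.fst measurable_fst)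

variable (lX lT η U p) in
/-- The integral of `φ` against the normalised expected utility. -/
def utilityMean (φ : X → ℝ) (ω : Ω) : ℝ :=
  (∫ x, φ x * expectedUtility lT (η ω) (U ω) (p ω) x ∂lX) /
    ∫ x, expectedUtility lT (η ω) (U ω) (p ω) x ∂lX

lemma measurable_utilityMean (mU : Measurable fun z : Ω × X × Θ => U z.1 z.2.1 z.2.2)
    (mp : Measurable fun z : Ω × X × Y × Θ => p z.1 z.2.1 z.2.2.1 z.2.2.2) {φ : X → ℝ}
    (hφ : Measurable φ) : Measurable (utilityMean lX lT η U p φ) := by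
  have m := stronglyMeasurable_expectedUtility (lT := lT) (η := η) mU mp
  have m1 : StronglyMeasurable fun w : Ω × X =>
      φ w.2 * expectedUtility lT (η w.1) (U w.1) (p w.1) w.2 :=
    (hφ.comp measurable_snd).stronglyMeasurable.mul m
  exact (m1.integral_prod_right' (ν := lX)).measurable.div
    (m.integral_prod_right' (ν := lX)).measurable

lemma utilityMean_eq (φ : X → ℝ) (ω : Ω) : utilityMean lX lT η U p φ ω =
    ∫ x, φ x * (expectedUtility lT (η ω) (U ω) (p ω) x /
      ∫ x, expectedUtility lT (η ω) (U ω) (p ω) x ∂lX) ∂lX := by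
  simp_rw [← mul_div_assoc]
  rw [integral_div, utilityMean]

lemma argmaxSet_div {X : Type*} (f : X → ℝ) {c : ℝ} (hc : 0 < c) :
    argmaxSet (fun x => f x / c) = argmaxSet f := by
  ext x
  simp [argmaxSet, div_le_div_iff_of_pos_right hc]

lemma ae_chainLaw {S : Type*} [MeasurableSpace S] {κ : Kernel S S} [IsMarkovKernel κ]
    {μ₀ : Measure S} {E : (ℕ → S) → Prop} (mE : MeasurableSet {z | E z})
    (h : ∀ᵐ s ∂μ₀, ∀ᵐ z ∂pathKernel κ s, E z) : ∀ᵐ z ∂chainLaw κ μ₀, E z := by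
  change chainLaw κ μ₀ {z | E z}ᶜ = 0
  rw [chainLaw_eq_bind, Measure.bind_apply mE.compl (Kernel.aemeasurable _),
    lintegral_eq_zero_iff (Kernel.measurable_coe _ mE.compl)]
  exact h

/-- The law of large numbers in a random environment. -/
theorem ae_tendsto_timeAverage_environment [lX.IsOpenPosMeasure]
    (mU : Measurable fun z : Ω × X × Θ => U z.1 z.2.1 z.2.2)
    (mp : Measurable fun z : Ω × X × Y × Θ => p z.1 z.2.1 z.2.2.1 z.2.2.2)
    (hG : ∀ ω ∈ G, IsMeasurableModel lX lT (U ω) (p ω) g)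
    {κ : Kernel (Ω × X × Y × Θ) (X × Y × Θ)} [IsMarkovKernel κ]
    (hκ : ∀ ω ∈ G, ∀ s, κ (ω, s) = mhStep lX (η ω) lT (U ω) (p ω) g s)
    {μ₀ : Measure (Ω × X × Y × Θ)} (hμ₀ : ∀ᵐ w ∂μ₀, w.1 ∈ G)
    {φ : X → ℝ} (hφ : Measurable φ) {C : ℝ} (hC : ∀ x, |φ x| ≤ C) :
    ∀ᵐ z ∂chainLaw (Kernel.deterministic Prod.fst measurable_fst ×ₖ κ) μ₀,
      Tendsto (fun n => timeAverage (fun w : Ω × X × Y × Θ => φ w.2.1) n z) atTop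
        (𝓝 (utilityMean lX lT η U p φ (z 0).1)) := by
  have mE : MeasurableSet {z : ℕ → Ω × X × Y × Θ | Tendsto
      (fun n => timeAverage (fun w : Ω × X × Y × Θ => φ w.2.1) n z) atTop
        (𝓝 (utilityMean lX lT η U p φ (z 0).1))} := by
    have mc : Measurable fun z : ℕ → Ω × X × Y × Θ => utilityMean lX lT η U p φ (z 0).1 :=
      (measurable_utilityMean mU mp hφ).comp (by fun_prop)
    -- The limit depends on the path through its environment, so measurability is obtained from the
    -- differences tending to `0`.
    have h1 : MeasurableSet {z : ℕ → Ω × X × Y × Θ | Tendsto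
        (fun n => timeAverage (fun w : Ω × X × Y × Θ => φ w.2.1) n z -
          utilityMean lX lT η U p φ (z 0).1) atTop (𝓝 0)} :=
      measurableSet_tendsto (𝓝 0) fun n => (measurable_timeAverage (by fun_prop) n).sub mc
    convert h1 using 3 with z
    exact tendsto_sub_nhds_zero_iff.symm
  refine ae_chainLaw (E := fun z => Tendsto
    (fun n => timeAverage (fun w : Ω × X × Y × Θ => φ w.2.1) n z) atTop
      (𝓝 (utilityMean lX lT η U p φ (z 0).1))) mE ?_
  filter_upwards [hμ₀] with w hw
  obtain ⟨ω, s⟩ := w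
  have m : Measurable (fun (z : ℕ → X × Y × Θ) i => (ω, z i)) := by fun_prop
  -- From the start `(ω, s)` the environment stays `ω`, and the claim becomes the law of large
  -- numbers for a fixed model.
  rw [pathKernel_deterministic_prod, ae_map_iff m.aemeasurable mE]
  have key := (hG ω hw).ae_tendsto_timeAverage (ν := η ω)
    (κ := κ.comap (fun s => (ω, s)) measurable_prodMk_left)
    (fun s => by rw [Kernel.comap_apply]; exact hκ ω hw s) hφ hC s
  filter_upwards [key] with z hz
  exact hz

end Environment

/-! ### The two algorithms -/

section Estimation

variable {X Y Θ : Type*} [MetricSpace X] [CompactSpace X] [Nonempty X]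
  [MeasurableSpace X] [BorelSpace X] [MeasurableSpace Y] [TopologicalSpace Θ] [MeasurableSpace Θ]
  {lX : Measure X} [IsFiniteMeasure lX] [lX.IsOpenPosMeasure] {lT : Measure Θ} [SigmaFinite lT]

lemma exists_abs_le_of_continuous {φ : X → ℝ} (hφ : Continuous φ) : ∃ C, ∀ x, |φ x| ≤ C := by
  obtain ⟨C, hC⟩ := isCompact_univ.exists_bound_of_continuousOn hφ.continuousOn
  exact ⟨C, fun x => hC x (Set.mem_univ x)⟩

lemma normalized_density {ν : Measure Y} [IsProbabilityMeasure ν] {u : X → Θ → ℝ}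
    {p : X → Y → Θ → ℝ} {g : X → X → ℝ} (h : IsMeasurableModel lX lT u p g) :
    Continuous (fun x => expectedUtility lT ν u p x / ∫ x, expectedUtility lT ν u p x ∂lX) ∧
    (∀ x, 0 ≤ expectedUtility lT ν u p x / ∫ x, expectedUtility lT ν u p x ∂lX) ∧
    ∫ x, expectedUtility lT ν u p x / (∫ x, expectedUtility lT ν u p x ∂lX) ∂lX = 1 :=
  ⟨h.continuous_expectedUtility.div_const _, fun x =>
    div_nonneg (h.expectedUtility_pos x).le h.integral_expectedUtility_pos.le, by
    rw [integral_div, div_self h.integral_expectedUtility_pos.ne']⟩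

/-- Parzen's estimator is consistent in a fixed environment. -/
theorem exists_consistent_bandwidths {ν : Measure Y} [IsProbabilityMeasure ν] {u : X → Θ → ℝ}
    {p : X → Y → Θ → ℝ} {g : X → X → ℝ} (h : IsMeasurableModel lX lT u p g)
    {κ : Kernel (X × Y × Θ) (X × Y × Θ)} [IsMarkovKernel κ]
    (hκ : ∀ s, κ s = mhStep lX ν lT u p g s) (μ₀ : Measure (X × Y × Θ)) [IsProbabilityMeasure μ₀]
    (b : ℕ) {K : ℝ → ℝ} (hK : IsSmoothingKernel K) :
    ∃ bw : ℕ → ℝ, (∀ n, 0 < bw n) ∧ Tendsto bw atTop (𝓝 0) ∧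
      ∀ m : (n : ℕ) → (Fin n → X) → X, IsParzenModeEstimator lX K bw m →
        IsConsistentModeEstimator (chainLaw κ μ₀) lX
          (fun _ => (augmented lX ν lT u p).map Prod.fst) (fun z i => (z (b + i)).1) m := by
  obtain ⟨bw, h1, h2, h3⟩ := exists_bandwidths (lX := lX) hK (Q := chainLaw κ μ₀)
    (obs := fun z i => (z (b + i)).1) (fun i => by fun_prop)
    (f := fun _ x => expectedUtility lT ν u p x / ∫ x, expectedUtility lT ν u p x ∂lX)
    (ae_of_all _ fun _ => normalized_density h) (fun φ _ => measurable_const) (fun φ hφ => by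
      obtain ⟨C, hC⟩ := exists_abs_le_of_continuous hφ
      simp_rw [← mul_div_assoc]
      rw [integral_div]
      have := ae_chainLaw (μ₀ := μ₀) (κ := κ) (measurableSet_tendsto (𝓝 _)
        (measurable_timeAverage (φ := fun s : X × Y × Θ => φ s.1) (by fun_prop)))
        (ae_of_all _ fun s => h.ae_tendsto_timeAverage hκ hφ.measurable hC s)
      filter_upwards [this] with z hz
      exact tendsto_timeAverage_add (fun s => hC _) b z hz)
  refine ⟨bw, h1, h2, fun m hm => ?_⟩
  filter_upwards [h3 m hm] with z hz
  rw [h.modeSet_eq]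
  rw [argmaxSet_div _ h.integral_expectedUtility_pos] at hz
  exact ⟨h.argmaxSet_nonempty, hz⟩

/-- Parzen's estimator is consistent in a random environment. -/
theorem exists_consistent_bandwidths_environment {Ω : Type*} [MeasurableSpace Ω]
    {η : Kernel Ω Y} [IsMarkovKernel η] {U : Ω → X → Θ → ℝ} {p : Ω → X → Y → Θ → ℝ}
    {g : X → X → ℝ} {G : Set Ω} (mU : Measurable fun z : Ω × X × Θ => U z.1 z.2.1 z.2.2)
    (mp : Measurable fun z : Ω × X × Y × Θ => p z.1 z.2.1 z.2.2.1 z.2.2.2)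
    (hG : ∀ ω ∈ G, IsMeasurableModel lX lT (U ω) (p ω) g)
    {κ : Kernel (Ω × X × Y × Θ) (X × Y × Θ)} [IsMarkovKernel κ]
    (hκ : ∀ ω ∈ G, ∀ s, κ (ω, s) = mhStep lX (η ω) lT (U ω) (p ω) g s)
    (μ₀ : Measure (Ω × X × Y × Θ)) [IsProbabilityMeasure μ₀] (hμ₀ : ∀ᵐ w ∂μ₀, w.1 ∈ G)
    (b : ℕ) {K : ℝ → ℝ} (hK : IsSmoothingKernel K) :
    ∃ bw : ℕ → ℝ, (∀ n, 0 < bw n) ∧ Tendsto bw atTop (𝓝 0) ∧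
      ∀ m : (n : ℕ) → (Fin n → X) → X, IsParzenModeEstimator lX K bw m →
        IsConsistentModeEstimator
          (chainLaw (Kernel.deterministic Prod.fst measurable_fst ×ₖ κ) μ₀) lX
          (fun z => (augmented lX (η (z 0).1) lT (U (z 0).1) (p (z 0).1)).map Prod.fst)
          (fun z i => (z (b + i)).2.1) m := by
  have hz0 : ∀ᵐ z ∂chainLaw (Kernel.deterministic Prod.fst measurable_fst ×ₖ κ) μ₀,
      (z 0).1 ∈ G := by
    rw [← chainLaw_map_zero (Kernel.deterministic Prod.fst measurable_fst ×ₖ κ) μ₀] at hμ₀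
    exact ae_of_ae_map (measurable_pi_apply 0).aemeasurable hμ₀
  obtain ⟨bw, h1, h2, h3⟩ := exists_bandwidths (lX := lX) hK
    (Q := chainLaw (Kernel.deterministic Prod.fst measurable_fst ×ₖ κ) μ₀)
    (obs := fun z i => (z (b + i)).2.1) (fun i => by fun_prop)
    (f := fun z x => expectedUtility lT (η (z 0).1) (U (z 0).1) (p (z 0).1) x /
      ∫ x, expectedUtility lT (η (z 0).1) (U (z 0).1) (p (z 0).1) x ∂lX)
    (hz0.mono fun z hz => normalized_density (hG _ hz)) (fun φ hφ => by
      simp_rw [← utilityMean_eq]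
      exact (measurable_utilityMean mU mp hφ.measurable).comp (by fun_prop)) (fun φ hφ => by
      obtain ⟨C, hC⟩ := exists_abs_le_of_continuous hφ
      simp_rw [← utilityMean_eq]
      filter_upwards [ae_tendsto_timeAverage_environment (lX := lX) mU mp hG hκ hμ₀
        hφ.measurable hC] with z hz
      exact tendsto_timeAverage_add (fun s => hC _) b z hz)
  refine ⟨bw, h1, h2, fun m hm => ?_⟩
  filter_upwards [h3 m hm, hz0] with z hz hzG
  rw [(hG _ hzG).modeSet_eq]
  rw [argmaxSet_div _ (hG _ hzG).integral_expectedUtility_pos] at hz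
  exact ⟨(hG _ hzG).argmaxSet_nonempty, hz⟩

end Estimation

end

end APS

/-! ### The two algorithms assembled -/

theorem proposition1
    {D A Θ Ω : Type*}
    [MetricSpace D] [CompactSpace D] [Nonempty D] [MeasurableSpace D] [BorelSpace D]
    [MetricSpace A] [CompactSpace A] [Nonempty A] [MeasurableSpace A] [BorelSpace A]
    [TopologicalSpace Θ] [MeasurableSpace Θ] [BorelSpace Θ]
    -- reference measures on the decision sets and on the outcomes
    (lD : Measure D) [IsFiniteMeasure lD] [lD.IsOpenPosMeasure]
    (lA : Measure A) [IsFiniteMeasure lA] [lA.IsOpenPosMeasure]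
    (lT : Measure Θ) [SigmaFinite lT]
    -- the Defender's utility `u_D(d,θ)` and outcome density `p_D(θ|d,a)`
    (uD : D → Θ → ℝ) (pD : D → A → Θ → ℝ)
    (pD_meas : Measurable fun z : D × A × Θ => pD z.1 z.2.1 z.2.2)
    (hD : APS.IsRegularModel lT uD pD)
    -- the Attacker's random utility `U_A(a,θ)`, random outcome density `P_A(θ|d,a)` and random
    -- forecast `P_A(d)` of the Defender's decision
    [MeasurableSpace Ω] (P : Measure Ω) [IsProbabilityMeasure P]
    (UA : Ω → A → Θ → ℝ) (UA_meas : Measurable fun z : Ω × A × Θ => UA z.1 z.2.1 z.2.2)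
    (PA : Ω → D → A → Θ → ℝ)
    (PA_meas : Measurable fun z : Ω × D × A × Θ => PA z.1 z.2.1 z.2.2.1 z.2.2.2)
    (PAd : Kernel Ω D) [IsMarkovKernel PAd]
    (hA : ∀ᵐ ω ∂P, APS.IsRegularModel lT (UA ω) (fun a d θ => PA ω d a θ))
    -- the proposals
    (gD : D → D → ℝ) (hgD : APS.IsFullProposal lD gD)
    (gA : A → A → ℝ) (hgA : APS.IsFullProposal lA gA)
    -- the random optimal attack `A*`, chosen measurably among the maximisers where there are any
    (Astar : Ω → A) (Astar_meas : Measurable Astar)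
    (hAstar : ∀ᵐ ω ∂P,
      (APS.argmaxSet (APS.expectedUtility lT (PAd ω) (UA ω) fun a d θ => PA ω d a θ)).Nonempty →
        Astar ω ∈ APS.argmaxSet
          (APS.expectedUtility lT (PAd ω) (UA ω) fun a d θ => PA ω d a θ)) :
    -- DAPS, where the Defender's forecast `p_D(a)` of the attack is the law of `A*`
    (∃ (κ : Kernel (D × A × Θ) (D × A × Θ)) (_ : IsMarkovKernel κ),
      APS.SamplesAugmented lD (P.map Astar) lT uD pD gD κ ∧
      -- for every initial law and every number `b` of discarded burn-in samples
      ∀ (μ₀ : Measure (D × A × Θ)) (_ : IsProbabilityMeasure μ₀) (b : ℕ),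
        (∀ m : (n : ℕ) → (Fin n → D) → D,
          APS.IsConsistentModeEstimator (APS.chainLaw κ μ₀) lD
            (fun _ => (APS.augmented lD (P.map Astar) lT uD pD).map Prod.fst)
            (fun z i => (z (b + i)).1) m →
          ∀ᵐ z ∂APS.chainLaw κ μ₀,
            Tendsto (fun n => Metric.infDist (m n fun i => (z (b + i)).1)
                (APS.argmaxSet (APS.expectedUtility lT (P.map Astar) uD pD)))
              atTop (𝓝 0)) ∧
        (∀ K : ℝ → ℝ, APS.IsSmoothingKernel K →
          ∃ h : ℕ → ℝ, (∀ n, 0 < h n) ∧ Tendsto h atTop (𝓝 0) ∧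
            ∀ m : (n : ℕ) → (Fin n → D) → D, APS.IsParzenModeEstimator lD K h m →
              APS.IsConsistentModeEstimator (APS.chainLaw κ μ₀) lD
                (fun _ => (APS.augmented lD (P.map Astar) lT uD pD).map Prod.fst)
                (fun z i => (z (b + i)).1) m)) ∧
    -- AAPS: `ω` is drawn from `P` once, and kept during the run of the chain
    (∃ (κ : Kernel (Ω × A × D × Θ) (A × D × Θ)) (_ : IsMarkovKernel κ),
      (∀ᵐ ω ∂P,
        APS.SamplesAugmented lA (PAd ω) lT (UA ω) (fun a d θ => PA ω d a θ) gA
          (κ.comap (fun s => (ω, s)) measurable_prodMk_left) ∧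
        Astar ω ∈ APS.argmaxSet
          (APS.expectedUtility lT (PAd ω) (UA ω) fun a d θ => PA ω d a θ)) ∧
      ∀ (μ₀ : Measure (Ω × A × D × Θ)) (_ : IsProbabilityMeasure μ₀) (b : ℕ), μ₀.fst = P →
        (∀ m : (n : ℕ) → (Fin n → A) → A,
          APS.IsConsistentModeEstimator
            (APS.chainLaw (Kernel.deterministic Prod.fst measurable_fst ×ₖ κ) μ₀) lA
            (fun z => (APS.augmented lA (PAd (z 0).1) lT (UA (z 0).1)
              fun a d θ => PA (z 0).1 d a θ).map Prod.fst)
            (fun z i => (z (b + i)).2.1) m →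
          (∀ᵐ z ∂APS.chainLaw (Kernel.deterministic Prod.fst measurable_fst ×ₖ κ) μ₀,
            Tendsto (fun n => Metric.infDist (m n fun i => (z (b + i)).2.1)
                (APS.argmaxSet (APS.expectedUtility lT (PAd (z 0).1) (UA (z 0).1)
                  fun a d θ => PA (z 0).1 d a θ)))
              atTop (𝓝 0)) ∧
          -- if the optimal attack is a.s. unique, the limit of the output has law `p_D(a)`
          ((∀ᵐ ω ∂P, (APS.argmaxSet (APS.expectedUtility lT (PAd ω) (UA ω)
              fun a d θ => PA ω d a θ)).Subsingleton) →
            ∃ L : (ℕ → Ω × A × D × Θ) → A, Measurable L ∧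
              (APS.chainLaw (Kernel.deterministic Prod.fst measurable_fst ×ₖ κ) μ₀).map L =
                P.map Astar ∧
              ∀ᵐ z ∂APS.chainLaw (Kernel.deterministic Prod.fst measurable_fst ×ₖ κ) μ₀,
                L z = Astar (z 0).1 ∧
                Tendsto (fun n => m n fun i => (z (b + i)).2.1) atTop (𝓝 (L z)))) ∧
        (∀ K : ℝ → ℝ, APS.IsSmoothingKernel K →
          ∃ h : ℕ → ℝ, (∀ n, 0 < h n) ∧ Tendsto h atTop (𝓝 0) ∧
            ∀ m : (n : ℕ) → (Fin n → A) → A, APS.IsParzenModeEstimator lA K h m →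
              APS.IsConsistentModeEstimator
                (APS.chainLaw (Kernel.deterministic Prod.fst measurable_fst ×ₖ κ) μ₀) lA
                (fun z => (APS.augmented lA (PAd (z 0).1) lT (UA (z 0).1)
                  fun a d θ => PA (z 0).1 d a θ).map Prod.fst)
                (fun z i => (z (b + i)).2.1) m)) := by
  classical
  have hPstar : IsProbabilityMeasure (P.map Astar) :=
    Measure.isProbabilityMeasure_map Astar_meas.aemeasurable
  refine ⟨?_, ?_⟩
  · have hM : APS.IsMeasurableModel lD lT uD pD gD :=
      -- `Θ` is an arbitrary topological space, so the product σ-algebra may be smaller than the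
      -- Borel one; the utility is jointly measurable as a Carathéodory function.
      ⟨measurable_uncurry_of_continuous_of_measurable
        (fun θ => hD.utility_continuous.comp (Continuous.prodMk_left θ))
        (fun d => (hD.utility_continuous.comp (Continuous.prodMk_right d)).measurable),
        pD_meas, hD, hgD⟩
    -- The Defender's chain is the case of a one-point environment.
    obtain ⟨κ', _, hκ'⟩ := APS.exists_mhKernel lD lT (Kernel.const Unit (P.map Astar))
      (U := fun _ => uD) (p := fun _ => pD) (g := gD) (G := Set.univ)
      (hM.measurable_utility.comp measurable_snd) (pD_meas.comp measurable_snd) hgD.measurable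
      MeasurableSet.univ (fun _ _ => hM)
    have hκ : ∀ s, κ'.comap (fun s => ((), s)) measurable_prodMk_left s =
        APS.mhStep lD (P.map Astar) lT uD pD gD s := fun s => by
      rw [Kernel.comap_apply]
      exact hκ' () (Set.mem_univ _) s
    refine ⟨κ'.comap (fun s => ((), s)) measurable_prodMk_left, inferInstance,
      hM.samplesAugmented hκ, fun μ₀ _ b => ⟨fun m hm => ?_, fun K hK =>
        APS.exists_consistent_bandwidths hM hκ μ₀ b hK⟩⟩
    filter_upwards [hm] with z hz
    rw [hM.modeSet_eq] at hz
    exact hz.2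
  -- The regular environments need not form a measurable set; the complement of a measurable null
  -- superset of the others does.
  · obtain ⟨N, hN, mN, hN0⟩ := exists_measurable_superset_of_null (ae_iff.1 hA)
    have hM : ∀ ω ∈ Nᶜ, APS.IsMeasurableModel lA lT (UA ω) (fun a d θ => PA ω d a θ) gA :=
      fun ω hω => ⟨UA_meas.comp measurable_prodMk_left,
        PA_meas.comp (f := fun z : A × D × Θ => (ω, z.2.1, z.1, z.2.2)) (by fun_prop),
        not_not.1 fun h => hω (hN h), hgA⟩
    have hPN : ∀ᵐ ω ∂P, ω ∈ Nᶜ := measure_eq_zero_iff_ae_notMem.1 hN0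
    have mPA : Measurable fun z : Ω × A × D × Θ => PA z.1 z.2.2.1 z.2.1 z.2.2.2 :=
      PA_meas.comp (f := fun z : Ω × A × D × Θ => (z.1, z.2.2.1, z.2.1, z.2.2.2)) (by fun_prop)
    obtain ⟨κ, hκM, hκ⟩ := APS.exists_mhKernel lA lT PAd
      (U := UA) (p := fun ω a d θ => PA ω d a θ) (g := gA) UA_meas mPA hgA.measurable mN.compl hM
    -- Regularity gives a continuous expected utility on a compact set, so maximisers exist almost
    -- surely and the condition on `Astar` is met.
    have hopt : ∀ᵐ ω ∂P, Astar ω ∈ APS.argmaxSet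
        (APS.expectedUtility lT (PAd ω) (UA ω) fun a d θ => PA ω d a θ) := by
      filter_upwards [hPN, hAstar] with ω hω hs
      exact hs (hM ω hω).argmaxSet_nonempty
    refine ⟨κ, hκM, ?_, fun μ₀ hμ₀ b hfst => ?_⟩
    · filter_upwards [hPN, hopt] with ω hω hs
      exact ⟨(hM ω hω).samplesAugmented fun s => by
        rw [Kernel.comap_apply]; exact hκ ω hω s, hs⟩
    set Q := APS.chainLaw (Kernel.deterministic Prod.fst measurable_fst ×ₖ κ) μ₀ with hQ
    have hμN : ∀ᵐ w ∂μ₀, w.1 ∈ Nᶜ := by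
      rw [← hfst] at hPN
      exact ae_of_ae_map measurable_fst.aemeasurable hPN
    have m0 : Measurable fun z : ℕ → Ω × A × D × Θ => (z 0).1 := by fun_prop
    -- The environment seen at time zero has law `P`, so statements for `P`-almost every `ω`
    -- transfer to almost every path.
    have hlaw : Q.map (fun z => (z 0).1) = P := by
      have h0 := APS.chainLaw_map_zero (Kernel.deterministic Prod.fst measurable_fst ×ₖ κ) μ₀
      rw [← hfst, Measure.fst, ← h0, Measure.map_map measurable_fst (measurable_pi_apply 0)]
      rfl
    have hQae : ∀ {R : Ω → Prop}, (∀ᵐ ω ∂P, R ω) → ∀ᵐ z ∂Q, R (z 0).1 := fun {R} hR => by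
      rw [← hlaw] at hR
      exact ae_of_ae_map m0.aemeasurable hR
    refine ⟨fun m hm => ?_, fun K hK =>
      APS.exists_consistent_bandwidths_environment UA_meas mPA hM hκ μ₀ hμN b hK⟩
    have happ : ∀ᵐ z ∂Q, Tendsto (fun n => Metric.infDist (m n fun i => (z (b + i)).2.1)
        (APS.argmaxSet (APS.expectedUtility lT (PAd (z 0).1) (UA (z 0).1)
          fun a d θ => PA (z 0).1 d a θ))) atTop (𝓝 0) := by
      filter_upwards [hm, hQae hPN] with z hz hzN
      rw [(hM _ hzN).modeSet_eq] at hz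
      exact hz.2
    -- The limit is the optimal attack in the drawn environment. With a single maximiser, the
    -- distance to the set of maximisers is the distance to this point.
    refine ⟨happ, fun huniq => ⟨fun z => Astar (z 0).1, Astar_meas.comp m0, ?_, ?_⟩⟩
    · rw [← hlaw, Measure.map_map Astar_meas m0]
      rfl
    · filter_upwards [happ, hQae hopt, hQae huniq] with z hz hzo hzu
      refine ⟨rfl, ?_⟩
      rw [hzu.eq_singleton_of_mem hzo] at hz
      simp only [Metric.infDist_singleton] at hz
      exact tendsto_iff_dist_tendsto_zero.2 hz
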